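/- \textbf{Setting.} Let $\gamma\ge 3$, $\kappa$, $m$ and $L\ge m+1$ be non-negative integers. Partition the all-ones $\gamma\times\kappa$ matrix into $m+1$ disjoint component matrices: $0$-$1$ matrices $H_0,\dots,H_m$ of size $\gamma\times\kappa$ with $\sum_{y=0}^m H_y$ equal to the all-ones matrix. The binary protograph of the spatially-coupled (SC) code is the bipartite graph of the $(L+m)\gamma\times L\kappa$ matrix $H_{SC}$ with $L+m$ block rows and $L$ block columns whose block in block row $R$ and block column $C$ is $H_{R-C}$ if $0\le R-C\le m$ and $0$ otherwise; rows are check nodes (CNs), columns are variable nodes (VNs), and ones are edges. The replica $\mathbf R_\rho$, $1\le\rho\le L$, consists of the columns of the $\rho$-th block column. Let $\Pi$ be the $(m+1)\gamma\times\kappa$ matrix obtained by stacking $H_0,\dots,H_m$, with rows indexed by $0,\dots,(m+1)\gamma-1$. For a set $s$ of row indices, the overlap parameter $t_s$ is the number of columns of $\Pi$ in which all the rows in $s$ have a $1$. Pattern $P_7$ is the $3\times4$ pattern with matrix $\begin{pmatrix}1&1&1&1\\1&1&0&0\\0&0&1&1\end{pmatrix}$: a CN $c_1$ joined to four VNs,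 a CN $c_2$ joined to two of them and a CN $c_3$ joined to the other two (two $c_1$--$c_2$ and two $c_1$--$c_3$ overlaps of degree 2). An instance of $P_7$ is a (not necessarily induced) subgraph of the protograph that is a copy of this bipartite graph, CNs going to CNs and VNs to VNs. Let $F_{P_7}$ be the number of instances, and let $F^k_{P_7,1}$ be the number of instances such that the smallest index of a replica containing one of its VNs is $1$ and the largest is $k$ (the instances that start at $\mathbf R_1$ and span $k$ consecutive replicas). \textbf{Notation.} $(x)^+=\max\{x,0\}$, $\overline{i}=i \bmod \gamma$, $[a,b]=\{a\gamma,a\gamma+1,\dots,b\gamma-1\}$, $t_{12}=t_{\{i_1,i_2\}}$, $t_{13}=t_{\{i_1,i_3\}}$, $t_{123}=t_{\{i_1,i_2,i_3\}}$, and for an integer $d$, $t_{12}^{d}=t_{\{i_1+d\gamma,\,i_2+d\gamma\}}$, $t_{13}^{d}=t_{\{i_1+d\gamma,\,i_3+d\gamma\}}$, $t_{123}^{d}=t_{\{i_1+d\gamma,\,i_2+d\gamma,\,i_3+d\gamma\}}$. With $$U(x,y,z)=z\,(y-1)^+ + (x-z)\,y$$ define \begin{align*} \mathcal A(x,y,z)&=\tbinom{z}{2}\tbinom{(y-2)^+}{2}+z(x-z)\tbinom{(y-1)^+}{2}+\tbinom{x-z}{2}\tbinom{y}{2},\\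 \mathcal B(x,y,z,p)&=\Big[\tbinom{z}{2}(y-2)^+ + z(x-z)(y-1)^+ + \tbinom{x-z}{2}y\Big]p,\\ \mathcal C(x,p)&=\tbinom{x}{2}\tbinom{p}{2},\qquad \mathcal D(x,y,z,x',y',z')=U(x,y,z)\,U(x',y',z'),\\ \mathcal E(x,p,q)&=\tbinom{x}{2}pq,\qquad \mathcal G(x,y,z,p,q)=U(x,y,z)\,pq,\qquad \mathcal I(x,p,q,r)=xpqr. \end{align*} All sums below run over $i_1\in I_1$, $i_2\in I_2$, $i_3\in I_3$ with $\overline{i_1}\ne\overline{i_2}$, $\overline{i_1}\ne\overline{i_3}$ and $i_2\ne i_3$, and the sum is written $\sum_{I_1;\,I_2;\,I_3}$. A sum written $\sum_{I_1;\,\{i_2,i_3\}\subset I}$ runs over $i_1\in I_1$ and unordered pairs $\{i_2,i_3\}\subset I$, under the same restrictions. \textbf{Theorem.} One has $$F_{P_7}=\sum_{k=1}^{m+1}(L-k+1)\,F^k_{P_7,1},$$ where, for $k\in\{1,\dots,m+1\}$, \begin{align*} F^1_{P_7,1}={}&\sum_{[0,m+1];\,\{i_2,i_3\}\subset[0,m+1]}\mathcal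 A(t_{12},t_{13},t_{123}),\\ F^2_{P_7,1}={}&\sum_{[1,m+1];[0,m+1];[1,m+1]}\mathcal B(t_{12},t_{13},t_{123},t_{13}^{-1}) +\sum_{[0,m];[0,m+1];[0,m]}\mathcal B(t_{12},t_{13},t_{123},t_{13}^{1})\\ &+\sum_{[1,m+1];[0,m+1];[1,m+2]}\mathcal C(t_{12},t_{13}^{-1}) +\sum_{[1,m+1];\{i_2,i_3\}\subset[1,m+1]}\mathcal D(t_{12},t_{13},t_{123},t_{12}^{-1},t_{13}^{-1},t_{123}^{-1}),\\ F^3_{P_7,1}={}&\sum_{[2,m+1];[0,m+1];[2,m+1]}\mathcal B(t_{12},t_{13},t_{123},t_{13}^{-2}) +\sum_{[0,m-1];[0,m+1];[0,m-1]}\mathcal B(t_{12},t_{13},t_{123},t_{13}^{2})\\ &+\sum_{[2,m+1];[0,m+1];[2,m+3]}\mathcal C(t_{12},t_{13}^{-2}) +\sum_{[2,m+1];\{i_2,i_3\}\subset[2,m+1]}\mathcal D(t_{12},t_{13},t_{123},t_{12}^{-2},t_{13}^{-2},t_{123}^{-2})\\ &+\sum_{[2,m+1];[0,m+1];[2,m+2]}\mathcal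 E(t_{12},t_{13}^{-1},t_{13}^{-2}) +\sum_{[1,m];[0,m+1];[1,m]}\mathcal E(t_{12},t_{13}^{1},t_{13}^{-1})\\ &+\sum_{[0,m-1];[0,m+1];[-1,m-1]}\mathcal E(t_{12},t_{13}^{2},t_{13}^{1}) +\sum_{[2,m+1];[1,m+1];[2,m+1]}\mathcal G(t_{12},t_{13},t_{123},t_{12}^{-1},t_{13}^{-2})\\ &+\sum_{[1,m];[0,m];[1,m+1]}\mathcal G(t_{12},t_{13},t_{123},t_{12}^{1},t_{13}^{-1}) +\sum_{[0,m-1];[0,m-1];[0,m]}\mathcal G(t_{12},t_{13},t_{123},t_{12}^{2},t_{13}^{1}), \end{align*} and for $k\ge4$ \begin{align*} F^k_{P_7,1}={}&\sum_{[k-1,m+1];[0,m+1];[k-1,m+1]}\mathcal B(t_{12},t_{13},t_{123},t_{13}^{1-k}) +\sum_{[0,m-k+2];[0,m+1];[0,m-k+2]}\mathcal B(t_{12},t_{13},t_{123},t_{13}^{k-1})\\ &+\sum_{[k-1,m+1];[0,m+1];[k-1,m+k]}\mathcal C(t_{12},t_{13}^{1-k}) +\sum_{[k-1,m+1];\{i_2,i_3\}\subset[k-1,m+1]}\mathcal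 D(t_{12},t_{13},t_{123},t_{12}^{1-k},t_{13}^{1-k},t_{123}^{1-k})\\ &+\sum_{h=2}^{k-1}\Big[\sum_{[k-1,m+1];[0,m+1];[k-1,m+h]}\mathcal E(t_{12},t_{13}^{1-h},t_{13}^{1-k}) +\sum_{[k-h,m-h+2];[0,m+1];[k-h,m-h+2]}\mathcal E(t_{12},t_{13}^{h-1},t_{13}^{h-k})\\ &\qquad+\sum_{[0,m-k+2];[0,m+1];[h-k,m-k+2]}\mathcal E(t_{12},t_{13}^{k-1},t_{13}^{k-h}) +\sum_{[k-1,m+1];[h-1,m+1];[k-1,m+1]}\mathcal G(t_{12},t_{13},t_{123},t_{12}^{1-h},t_{13}^{1-k})\\ &\qquad+\sum_{[k-h,m-h+2];[0,m-h+2];[k-h,m+1]}\mathcal G(t_{12},t_{13},t_{123},t_{12}^{h-1},t_{13}^{h-k})\\ &\qquad+\sum_{[0,m-k+2];[0,m-k+2];[0,m-k+h+1]}\mathcal G(t_{12},t_{13},t_{123},t_{12}^{k-1},t_{13}^{k-h})\Big]\\ &+\sum_{h=2}^{k-2}\sum_{w=h+1}^{k-1}\Big[\sum_{[k-1,m+1];[h-1,m+1];[k-1,m+w]}\mathcal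 I(t_{12},t_{12}^{1-h},t_{13}^{1-w},t_{13}^{1-k})\\ &\qquad+\sum_{[k-1,m+1];[w-1,m+1];[k-1,m+h]}\mathcal I(t_{12},t_{12}^{1-w},t_{13}^{1-h},t_{13}^{1-k})\\ &\qquad+\sum_{[k-1,m+1];[k-1,m+1];[w-1,m+h]}\mathcal I(t_{12},t_{12}^{1-k},t_{13}^{1-h},t_{13}^{1-w})\Big]. \end{align*} -/

import Mathlib

namespace SCCode

/-! ### The protograph of a spatially-coupled code -/

/-- The matrix obtained by coupling the `γ × κ` component matrices `H 0, …, H m` `L` times: it has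
`L + m` block rows and `L` block columns, the block in block row `R` and block column `C` is `H y`
if `R = C + y` with `0 ≤ y ≤ m`, and it is `0` otherwise. -/
def scMatrix {γ κ m : ℕ} (L : ℕ) (H : Fin (m + 1) → Matrix (Fin γ) (Fin κ) ℕ) :
    Matrix (Fin ((L + m) * γ)) (Fin (L * κ)) ℕ :=
  Matrix.of fun i j =>
    ∑ y : Fin (m + 1),
      if (i.divNat : ℕ) = (j.divNat : ℕ) + (y : ℕ) then H y i.modNat j.modNat else 0

/-- The `(m + 1)γ × κ` matrix that stacks `H 0, …, H m` on top of each other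
(the non-zero part of a replica). -/
def stackedMatrix {γ κ m : ℕ} (H : Fin (m + 1) → Matrix (Fin γ) (Fin κ) ℕ) :
    Matrix (Fin ((m + 1) * γ)) (Fin κ) ℕ :=
  Matrix.of fun i j => H i.divNat i.modNat j

/-- The overlap parameter `t_s` of a set `s` of row indices of the stacked matrix: the number of
columns in which all the rows indexed by `s` have a `1`.  (Row indices are integers because the
formulas below shift them; an index outside `{0, …, (m + 1)γ - 1}` is not a row.) -/
noncomputable def overlapParam {γ κ m : ℕ} (H : Fin (m + 1) → Matrix (Fin γ) (Fin κ) ℕ) (s : Finset ℤ) : ℕ :=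
  Set.ncard {j : Fin κ | ∀ i ∈ s, ∃ a : Fin ((m + 1) * γ), (a : ℤ) = i ∧ stackedMatrix H a j = 1}

/-! ### Instances of a pattern -/

/-- `S` is an instance of the pattern with `0`-`1` matrix `P` in the graph of the `0`-`1` matrix
`A`: a set of edges (positions of `1`s) of `A` that is the image of the set of edges of `P` under an
injective map of rows (check nodes) and an injective map of columns (variable nodes).  In other
words, `S` is (the edge set of) a subgraph of the graph of `A` that is a copy of the graph of `P`. -/
def IsPatternInstance {a b : ℕ} {R C : Type*} (P : Matrix (Fin a) (Fin b) ℕ) (A : Matrix R C ℕ)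
    (S : Finset (R × C)) : Prop :=
  (∃ f : Fin a ↪ R, ∃ g : Fin b ↪ C, ∀ e : R × C, e ∈ S ↔ ∃ x y, P x y = 1 ∧ e = (f x, g y)) ∧
    ∀ e ∈ S, A e.1 e.2 = 1

/-- The `3 × 4` pattern: `c₁` is joined to the four variable nodes, `c₂` to two of them and `c₃` to
the other two. -/
def P7 : Matrix (Fin 3) (Fin 4) ℕ :=
  !![1, 1, 1, 1;
     1, 1, 0, 0;
     0, 0, 1, 1]

/-- The number of the replica, in `{1, …, L}`, that contains a given column. -/
def replica {L κ : ℕ} (j : Fin (L * κ)) : ℕ := (j.divNat : ℕ) + 1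

/-- The variable nodes of `S` start at the first replica and span `k` consecutive replicas:
the smallest replica that contains one of them is `1`, and the largest one is `k`. -/
def StartsAtOneAndSpans {R : Type*} {L κ : ℕ} (S : Finset (R × Fin (L * κ))) (k : ℕ) : Prop :=
  (∃ e ∈ S, replica e.2 = 1) ∧ (∃ e ∈ S, replica e.2 = k) ∧ ∀ e ∈ S, replica e.2 ≤ k

/-- The total number of instances of the `3 × 4` pattern in the protograph. -/
noncomputable def numP7 {γ κ m : ℕ} (L : ℕ) (H : Fin (m + 1) → Matrix (Fin γ) (Fin κ) ℕ) : ℕ :=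
  Set.ncard {S : Finset (Fin ((L + m) * γ) × Fin (L * κ)) | IsPatternInstance P7 (scMatrix L H) S}

/-- The number of instances of the `3 × 4` pattern in the protograph that start at the first
replica and span `k` consecutive replicas. -/
noncomputable def numP7Span {γ κ m : ℕ} (L : ℕ) (H : Fin (m + 1) → Matrix (Fin γ) (Fin κ) ℕ)
    (k : ℕ) : ℕ :=
  Set.ncard {S : Finset (Fin ((L + m) * γ) × Fin (L * κ)) |
    IsPatternInstance P7 (scMatrix L H) S ∧ StartsAtOneAndSpans S k}

/-! ### The seven case functions

All arguments are overlap parameters, hence natural numbers.  Truncated subtraction on `ℕ` is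
`(x - y)⁺`; the differences `t₁₂ - t₁₂₃` are always taken with `t₁₂₃ ≤ t₁₂`. -/

def caseA (t12 t13 t123 : ℕ) : ℕ :=
  t123.choose 2 * (t13 - 2).choose 2 + t123 * (t12 - t123) * (t13 - 1).choose 2
    + (t12 - t123).choose 2 * t13.choose 2

def caseB (t12 t13 t123 e13 : ℕ) : ℕ :=
  (t123.choose 2 * (t13 - 2) + t123 * (t12 - t123) * (t13 - 1) + (t12 - t123).choose 2 * t13) * e13

def caseC (t12 e13 : ℕ) : ℕ := t12.choose 2 * e13.choose 2

def caseD (t12 t13 t123 e12 e13 e123 : ℕ) : ℕ :=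
  (t123 * (t13 - 1) + (t12 - t123) * t13) * (e123 * (e13 - 1) + (e12 - e123) * e13)

def caseE (t12 e13 s13 : ℕ) : ℕ := t12.choose 2 * e13 * s13

def caseG (t12 t13 t123 e12 s13 : ℕ) : ℕ :=
  (t123 * (t13 - 1) + (t12 - t123) * t13) * e12 * s13

def caseI (t12 e12 s13 u13 : ℕ) : ℕ := t12 * e12 * s13 * u13

/-! ### The closed formula -/

/-- The sum of `f i₁ i₂ i₃` over `i₁ ∈ {a₁, …, b₁}`, `i₂ ∈ {a₂, …, b₂}`, `i₃ ∈ {a₃, …, b₃}` such that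
`i₁ ≢ i₂` and `i₁ ≢ i₃` modulo `γ` and `i₂ ≠ i₃`. -/
noncomputable def sumTriples (γ a₁ b₁ a₂ b₂ a₃ b₃ : ℤ) (f : ℤ → ℤ → ℤ → ℕ) : ℕ :=
  ∑ i₁ ∈ Finset.Icc a₁ b₁, ∑ i₂ ∈ Finset.Icc a₂ b₂, ∑ i₃ ∈ Finset.Icc a₃ b₃,
    if i₁ % γ ≠ i₂ % γ ∧ i₁ % γ ≠ i₃ % γ ∧ i₂ ≠ i₃ then f i₁ i₂ i₃ else 0

/-- The sum of `f i₁ i₂ i₃` over `i₁ ∈ {a₁, …, b₁}` and unordered pairs `{i₂, i₃} ⊂ {a, …, b}`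
such that `i₁ ≢ i₂` and `i₁ ≢ i₃` modulo `γ`; a pair is listed with its smaller element first.
(The summands below are symmetric in `i₂` and `i₃`.) -/
noncomputable def sumPairs (γ a₁ b₁ a b : ℤ) (f : ℤ → ℤ → ℤ → ℕ) : ℕ :=
  ∑ i₁ ∈ Finset.Icc a₁ b₁, ∑ i₂ ∈ Finset.Icc a b, ∑ i₃ ∈ Finset.Icc a b,
    if i₁ % γ ≠ i₂ % γ ∧ i₁ % γ ≠ i₃ % γ ∧ i₂ < i₃ then f i₁ i₂ i₃ else 0

/-- The formula for `k = 1`. -/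
noncomputable def formula1 (γ m : ℤ) (t : Finset ℤ → ℕ) : ℕ :=
  sumPairs γ 0 ((m + 1) * γ - 1) 0 ((m + 1) * γ - 1) (fun i₁ i₂ i₃ =>
    caseA (t {i₁, i₂}) (t {i₁, i₃}) (t {i₁, i₂, i₃}))

/-- The formula for `k = 2`. -/
noncomputable def formula2 (γ m : ℤ) (t : Finset ℤ → ℕ) : ℕ :=
  sumTriples γ γ ((m + 1) * γ - 1) 0 ((m + 1) * γ - 1) γ ((m + 1) * γ - 1) (fun i₁ i₂ i₃ =>
    caseB (t {i₁, i₂}) (t {i₁, i₃}) (t {i₁, i₂, i₃}) (t {i₁ - γ, i₃ - γ}))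
  + sumTriples γ 0 (m * γ - 1) 0 ((m + 1) * γ - 1) 0 (m * γ - 1) (fun i₁ i₂ i₃ =>
    caseB (t {i₁, i₂}) (t {i₁, i₃}) (t {i₁, i₂, i₃}) (t {i₁ + γ, i₃ + γ}))
  + sumTriples γ γ ((m + 1) * γ - 1) 0 ((m + 1) * γ - 1) γ ((m + 2) * γ - 1) (fun i₁ i₂ i₃ =>
    caseC (t {i₁, i₂}) (t {i₁ - γ, i₃ - γ}))
  + sumPairs γ γ ((m + 1) * γ - 1) γ ((m + 1) * γ - 1) (fun i₁ i₂ i₃ =>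
    caseD (t {i₁, i₂}) (t {i₁, i₃}) (t {i₁, i₂, i₃})
      (t {i₁ - γ, i₂ - γ}) (t {i₁ - γ, i₃ - γ}) (t {i₁ - γ, i₂ - γ, i₃ - γ}))

/-- The formula for `k = 3`. -/
noncomputable def formula3 (γ m : ℤ) (t : Finset ℤ → ℕ) : ℕ :=
  sumTriples γ (2 * γ) ((m + 1) * γ - 1) 0 ((m + 1) * γ - 1) (2 * γ) ((m + 1) * γ - 1)
    (fun i₁ i₂ i₃ =>
      caseB (t {i₁, i₂}) (t {i₁, i₃}) (t {i₁, i₂, i₃}) (t {i₁ - 2 * γ, i₃ - 2 * γ}))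
  + sumTriples γ 0 ((m - 1) * γ - 1) 0 ((m + 1) * γ - 1) 0 ((m - 1) * γ - 1)
    (fun i₁ i₂ i₃ =>
      caseB (t {i₁, i₂}) (t {i₁, i₃}) (t {i₁, i₂, i₃}) (t {i₁ + 2 * γ, i₃ + 2 * γ}))
  + sumTriples γ (2 * γ) ((m + 1) * γ - 1) 0 ((m + 1) * γ - 1) (2 * γ) ((m + 3) * γ - 1)
    (fun i₁ i₂ i₃ =>
      caseC (t {i₁, i₂}) (t {i₁ - 2 * γ, i₃ - 2 * γ}))
  + sumPairs γ (2 * γ) ((m + 1) * γ - 1) (2 * γ) ((m + 1) * γ - 1)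
    (fun i₁ i₂ i₃ =>
      caseD (t {i₁, i₂}) (t {i₁, i₃}) (t {i₁, i₂, i₃})
        (t {i₁ - 2 * γ, i₂ - 2 * γ}) (t {i₁ - 2 * γ, i₃ - 2 * γ})
        (t {i₁ - 2 * γ, i₂ - 2 * γ, i₃ - 2 * γ}))
  + sumTriples γ (2 * γ) ((m + 1) * γ - 1) 0 ((m + 1) * γ - 1) (2 * γ) ((m + 2) * γ - 1)
    (fun i₁ i₂ i₃ =>
      caseE (t {i₁, i₂}) (t {i₁ - γ, i₃ - γ}) (t {i₁ - 2 * γ, i₃ - 2 * γ}))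
  + sumTriples γ γ (m * γ - 1) 0 ((m + 1) * γ - 1) γ (m * γ - 1)
    (fun i₁ i₂ i₃ =>
      caseE (t {i₁, i₂}) (t {i₁ + γ, i₃ + γ}) (t {i₁ - γ, i₃ - γ}))
  + sumTriples γ 0 ((m - 1) * γ - 1) 0 ((m + 1) * γ - 1) (-γ) ((m - 1) * γ - 1)
    (fun i₁ i₂ i₃ =>
      caseE (t {i₁, i₂}) (t {i₁ + 2 * γ, i₃ + 2 * γ}) (t {i₁ + γ, i₃ + γ}))
  + sumTriples γ (2 * γ) ((m + 1) * γ - 1) γ ((m + 1) * γ - 1) (2 * γ) ((m + 1) * γ - 1)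
    (fun i₁ i₂ i₃ =>
      caseG (t {i₁, i₂}) (t {i₁, i₃}) (t {i₁, i₂, i₃})
        (t {i₁ - γ, i₂ - γ}) (t {i₁ - 2 * γ, i₃ - 2 * γ}))
  + sumTriples γ γ (m * γ - 1) 0 (m * γ - 1) γ ((m + 1) * γ - 1)
    (fun i₁ i₂ i₃ =>
      caseG (t {i₁, i₂}) (t {i₁, i₃}) (t {i₁, i₂, i₃})
        (t {i₁ + γ, i₂ + γ}) (t {i₁ - γ, i₃ - γ}))
  + sumTriples γ 0 ((m - 1) * γ - 1) 0 ((m - 1) * γ - 1) 0 (m * γ - 1)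
    (fun i₁ i₂ i₃ =>
      caseG (t {i₁, i₂}) (t {i₁, i₃}) (t {i₁, i₂, i₃})
        (t {i₁ + 2 * γ, i₂ + 2 * γ}) (t {i₁ + γ, i₃ + γ}))

/-- The formula for `k ≥ 4`. -/
noncomputable def formula4 (γ m k : ℤ) (t : Finset ℤ → ℕ) : ℕ :=
  sumTriples γ ((k - 1) * γ) ((m + 1) * γ - 1) 0 ((m + 1) * γ - 1)
      ((k - 1) * γ) ((m + 1) * γ - 1) (fun i₁ i₂ i₃ =>
    caseB (t {i₁, i₂}) (t {i₁, i₃}) (t {i₁, i₂, i₃}) (t {i₁ + (1 - k) * γ, i₃ + (1 - k) * γ}))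
  + sumTriples γ 0 ((m - k + 2) * γ - 1) 0 ((m + 1) * γ - 1)
      0 ((m - k + 2) * γ - 1) (fun i₁ i₂ i₃ =>
    caseB (t {i₁, i₂}) (t {i₁, i₃}) (t {i₁, i₂, i₃}) (t {i₁ + (k - 1) * γ, i₃ + (k - 1) * γ}))
  + sumTriples γ ((k - 1) * γ) ((m + 1) * γ - 1) 0 ((m + 1) * γ - 1)
      ((k - 1) * γ) ((m + k) * γ - 1) (fun i₁ i₂ i₃ =>
    caseC (t {i₁, i₂}) (t {i₁ + (1 - k) * γ, i₃ + (1 - k) * γ}))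
  + sumPairs γ ((k - 1) * γ) ((m + 1) * γ - 1)
      ((k - 1) * γ) ((m + 1) * γ - 1) (fun i₁ i₂ i₃ =>
    caseD (t {i₁, i₂}) (t {i₁, i₃}) (t {i₁, i₂, i₃})
      (t {i₁ + (1 - k) * γ, i₂ + (1 - k) * γ}) (t {i₁ + (1 - k) * γ, i₃ + (1 - k) * γ})
      (t {i₁ + (1 - k) * γ, i₂ + (1 - k) * γ, i₃ + (1 - k) * γ}))
  + (∑ h ∈ Finset.Icc 2 (k - 1),
      sumTriples γ ((k - 1) * γ) ((m + 1) * γ - 1) 0 ((m + 1) * γ - 1)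
        ((k - 1) * γ) ((m + h) * γ - 1) (fun i₁ i₂ i₃ =>
      caseE (t {i₁, i₂}) (t {i₁ + (1 - h) * γ, i₃ + (1 - h) * γ})
        (t {i₁ + (1 - k) * γ, i₃ + (1 - k) * γ})))
  + (∑ h ∈ Finset.Icc 2 (k - 1),
      sumTriples γ ((k - h) * γ) ((m - h + 2) * γ - 1) 0 ((m + 1) * γ - 1)
        ((k - h) * γ) ((m - h + 2) * γ - 1) (fun i₁ i₂ i₃ =>
      caseE (t {i₁, i₂}) (t {i₁ + (h - 1) * γ, i₃ + (h - 1) * γ})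
        (t {i₁ + (h - k) * γ, i₃ + (h - k) * γ})))
  + (∑ h ∈ Finset.Icc 2 (k - 1),
      sumTriples γ 0 ((m - k + 2) * γ - 1) 0 ((m + 1) * γ - 1)
        ((h - k) * γ) ((m - k + 2) * γ - 1) (fun i₁ i₂ i₃ =>
      caseE (t {i₁, i₂}) (t {i₁ + (k - 1) * γ, i₃ + (k - 1) * γ})
        (t {i₁ + (k - h) * γ, i₃ + (k - h) * γ})))
  + (∑ h ∈ Finset.Icc 2 (k - 1),
      sumTriples γ ((k - 1) * γ) ((m + 1) * γ - 1) ((h - 1) * γ) ((m + 1) * γ - 1)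
        ((k - 1) * γ) ((m + 1) * γ - 1) (fun i₁ i₂ i₃ =>
      caseG (t {i₁, i₂}) (t {i₁, i₃}) (t {i₁, i₂, i₃})
        (t {i₁ + (1 - h) * γ, i₂ + (1 - h) * γ}) (t {i₁ + (1 - k) * γ, i₃ + (1 - k) * γ})))
  + (∑ h ∈ Finset.Icc 2 (k - 1),
      sumTriples γ ((k - h) * γ) ((m - h + 2) * γ - 1) 0 ((m - h + 2) * γ - 1)
        ((k - h) * γ) ((m + 1) * γ - 1) (fun i₁ i₂ i₃ =>
      caseG (t {i₁, i₂}) (t {i₁, i₃}) (t {i₁, i₂, i₃})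
        (t {i₁ + (h - 1) * γ, i₂ + (h - 1) * γ}) (t {i₁ + (h - k) * γ, i₃ + (h - k) * γ})))
  + (∑ h ∈ Finset.Icc 2 (k - 1),
      sumTriples γ 0 ((m - k + 2) * γ - 1) 0 ((m - k + 2) * γ - 1)
        0 ((m - k + h + 1) * γ - 1) (fun i₁ i₂ i₃ =>
      caseG (t {i₁, i₂}) (t {i₁, i₃}) (t {i₁, i₂, i₃})
        (t {i₁ + (k - 1) * γ, i₂ + (k - 1) * γ}) (t {i₁ + (k - h) * γ, i₃ + (k - h) * γ})))
  + (∑ h ∈ Finset.Icc 2 (k - 2), ∑ w ∈ Finset.Icc (h + 1) (k - 1),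
      sumTriples γ ((k - 1) * γ) ((m + 1) * γ - 1) ((h - 1) * γ) ((m + 1) * γ - 1)
        ((k - 1) * γ) ((m + w) * γ - 1) (fun i₁ i₂ i₃ =>
      caseI (t {i₁, i₂}) (t {i₁ + (1 - h) * γ, i₂ + (1 - h) * γ})
        (t {i₁ + (1 - w) * γ, i₃ + (1 - w) * γ}) (t {i₁ + (1 - k) * γ, i₃ + (1 - k) * γ})))
  + (∑ h ∈ Finset.Icc 2 (k - 2), ∑ w ∈ Finset.Icc (h + 1) (k - 1),
      sumTriples γ ((k - 1) * γ) ((m + 1) * γ - 1) ((w - 1) * γ) ((m + 1) * γ - 1)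
        ((k - 1) * γ) ((m + h) * γ - 1) (fun i₁ i₂ i₃ =>
      caseI (t {i₁, i₂}) (t {i₁ + (1 - w) * γ, i₂ + (1 - w) * γ})
        (t {i₁ + (1 - h) * γ, i₃ + (1 - h) * γ}) (t {i₁ + (1 - k) * γ, i₃ + (1 - k) * γ})))
  + (∑ h ∈ Finset.Icc 2 (k - 2), ∑ w ∈ Finset.Icc (h + 1) (k - 1),
      sumTriples γ ((k - 1) * γ) ((m + 1) * γ - 1) ((k - 1) * γ) ((m + 1) * γ - 1)
        ((w - 1) * γ) ((m + h) * γ - 1) (fun i₁ i₂ i₃ =>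
      caseI (t {i₁, i₂}) (t {i₁ + (1 - k) * γ, i₂ + (1 - k) * γ})
        (t {i₁ + (1 - h) * γ, i₃ + (1 - h) * γ}) (t {i₁ + (1 - w) * γ, i₃ + (1 - w) * γ})))

/-- The formula for the number of instances that start at the first replica and span `k ≥ 1`
replicas, in terms of the overlap parameters `t`. -/
noncomputable def formulaP7 (γ m k : ℕ) (t : Finset ℤ → ℕ) : ℕ :=
  if k = 1 then formula1 γ m t
  else if k = 2 then formula2 γ m t
  else if k = 3 then formula3 γ m t
  else formula4 γ m k t

end SCCode

/-! An instance of `P7` is the same thing as a check node `c₁`, an unordered pair of further check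
nodes `c₂`, `c₃`, and disjoint 2-sets `P`, `Q` of columns, where `P` lies in the common
neighbourhood of `c₁`, `c₂` and `Q` in that of `c₁`, `c₃`. For fixed check nodes the number of
choices of `(P, Q)` is `caseA x y z`, where `x`, `y` are the sizes of the two common neighbourhoods
and `z` that of their intersection (`card_disjoint_pairs`, `ncard_isPatternInstance_P7`).

If the columns are confined to a window of consecutive replicas, then `x`, `y`, `z` are sums over
the window of overlap parameters with shifted rows (`card_window_filter`). The instances that use
both end replicas of the window `1, …, k` are counted by inclusion-exclusion over the four windows
obtained by keeping or dropping each end. This second difference of `caseA` is evaluated in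
`caseA_window`: since `z ≤ x` and `z ≤ y`, the truncated subtractions do no harm, `caseA` is a
polynomial, and its second difference splits into the terms B, C, D, E, G, I according to how the
four columns are distributed over the replicas.

It remains to recognise the closed formula. Each of its sums measures rows relative to one replica.
A translation turns them into rows of the coupled matrix, and the ranges of summation matter only in
that they contain the support of the summand (`sum_box_shift`). Sums over ordered `(i₂, i₃)` fold to
unordered pairs (`sumTriples_shift`). The outcome does not depend on the number `a` of replicas
before the window (`ncard_spansFrom`). All neighbours of `c₁` lie in `m + 1` consecutive replicas,
so each instance has a unique span of length `k ≤ m + 1`, and a span of length `k` has `L - k + 1`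
positions (`numP7_eq_sum`). -/

namespace SCCode

/-! ### Case functions as polynomials, and the window identity -/

/-- The number of pairs `(u, v)` of distinct elements with `u` in one set and `v` in another one. -/
def offDiagCount (x y z : ℕ) : ℕ := z * (y - 1) + (x - z) * y

theorem cast_offDiagCount {x y z : ℕ} (hx : z ≤ x) (hy : z ≤ y) :
    (offDiagCount x y z : ℚ) = x * y - z := by
  unfold offDiagCount
  rcases Nat.eq_zero_or_pos z with rfl | hz
  · simp
  · push_cast [Nat.cast_sub hx, Nat.cast_sub (hz.trans_le hy)]
    ring

/-- Inclusion-exclusion over common elements: the indicator of `P ∩ Q = ∅` is `1 - n + n.choose 2`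
with `n = |P ∩ Q| ≤ 2`. A marked common element gives `z (x - 1) (y - 1)` pairs, two marked ones
force `P = Q` inside the intersection. -/
theorem cast_caseA {x y z : ℕ} (hx : z ≤ x) (hy : z ≤ y) :
    (caseA x y z : ℚ) = x * (x - 1) / 2 * (y * (y - 1) / 2) - z * (x - 1) * (y - 1)
      + z * (z - 1) / 2 := by
  unfold caseA
  obtain ⟨d, rfl⟩ := Nat.exists_eq_add_of_le hx
  obtain ⟨e, rfl⟩ := Nat.exists_eq_add_of_le hy
  -- Where `y - 1` or `y - 2` could be truncated, its coefficient vanishes: `z = 0` kills both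
  -- terms, `z = 1` kills the one with `y - 2`.
  rcases z with _ | _ | z
  · simp [Nat.cast_choose_two]
  · have h : 0 + 1 + e - 1 = e := by omega
    have h' : 0 + 1 + d - (0 + 1) = d := by omega
    simp only [h, h']
    push_cast [Nat.cast_choose_two]
    norm_num
    ring
  · have h1 : z + 1 + 1 + e - 2 = z + e := by omega
    have h2 : z + 1 + 1 + e - 1 = z + 1 + e := by omega
    have h3 : z + 1 + 1 + d - (z + 1 + 1) = d := by omega
    simp only [h1, h2, h3]
    push_cast [Nat.cast_choose_two]
    ring

/-- Choose a 2-set in the first set and an element of the second one, and discard the choices whose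
element lies in the 2-set: there are `z (x - 1)` of these. The factor `p` is a free choice in
another replica. -/
theorem cast_caseB {x y z : ℕ} (p : ℕ) (hx : z ≤ x) (hy : z ≤ y) :
    (caseB x y z p : ℚ) = (x * (x - 1) / 2 * y - z * (x - 1)) * p := by
  unfold caseB
  obtain ⟨d, rfl⟩ := Nat.exists_eq_add_of_le hx
  obtain ⟨e, rfl⟩ := Nat.exists_eq_add_of_le hy
  rcases z with _ | _ | z
  · simp [Nat.cast_choose_two]
  · have h : 0 + 1 + e - 1 = e := by omega
    have h' : 0 + 1 + d - (0 + 1) = d := by omega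
    simp only [h, h']
    push_cast [Nat.cast_choose_two]
    norm_num
    left
    ring
  · have h1 : z + 1 + 1 + e - 2 = z + e := by omega
    have h2 : z + 1 + 1 + e - 1 = z + 1 + e := by omega
    have h3 : z + 1 + 1 + d - (z + 1 + 1) = d := by omega
    simp only [h1, h2, h3]
    push_cast [Nat.cast_choose_two]
    ring

/-- Splitting an iterated sum over an interval into its diagonal and its two halves. -/
theorem sum_Icc_mul_sum_Icc (u v : ℤ → ℚ) (a : ℤ) (n : ℕ) :
    (∑ h ∈ Finset.Icc a (a + n - 1), u h) * ∑ h ∈ Finset.Icc a (a + n - 1), v h =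
      ∑ h ∈ Finset.Icc a (a + n - 1), u h * v h +
      ∑ h ∈ Finset.Icc a (a + n - 2), ∑ w ∈ Finset.Icc (h + 1) (a + n - 1),
        (u h * v w + u w * v h) := by
  have key : ∀ (n : ℕ) (f : ℤ → ℚ), ∑ h ∈ Finset.Icc a (a + (n + 1 : ℕ) - 1), f h =
      ∑ h ∈ Finset.Icc a (a + n - 1), f h + f (a + n) := by
    intro n f
    have : Finset.Icc a (a + (n + 1 : ℕ) - 1) = insert (a + n) (Finset.Icc a (a + n - 1)) := by
      ext i; simp only [Finset.mem_Icc, Finset.mem_insert]; push_cast; omega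
    rw [this, Finset.sum_insert (by simp), add_comm]
  induction n with
  | zero => simp
  | succ n ih =>
    have h2 : a + ((n + 1 : ℕ) : ℤ) - 2 = a + n - 1 := by push_cast; ring
    have h3 : ∀ h ∈ Finset.Icc a (a + n - 1),
        ∑ w ∈ Finset.Icc (h + 1) (a + (n + 1 : ℕ) - 1), (u h * v w + u w * v h) =
        ∑ w ∈ Finset.Icc (h + 1) (a + n - 1), (u h * v w + u w * v h) +
          (u h * v (a + n) + u (a + n) * v h) := by
      intro h hh
      rw [Finset.mem_Icc] at hh
      have : Finset.Icc (h + 1) (a + (n + 1 : ℕ) - 1) =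
          insert (a + n : ℤ) (Finset.Icc (h + 1) (a + n - 1)) := by
        ext i; simp only [Finset.mem_Icc, Finset.mem_insert]; push_cast; omega
      rw [this, Finset.sum_insert (by simp), add_comm]
    -- The outer index `h = a + n - 1` has an empty inner sum, so the outer range may stop one
    -- earlier.
    have h4 : ∑ h ∈ Finset.Icc a (a + n - 1), ∑ w ∈ Finset.Icc (h + 1) (a + n - 1),
        (u h * v w + u w * v h) =
        ∑ h ∈ Finset.Icc a (a + n - 2), ∑ w ∈ Finset.Icc (h + 1) (a + n - 1),
        (u h * v w + u w * v h) := by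
      symm
      apply Finset.sum_subset
      · intro i; simp only [Finset.mem_Icc]; omega
      · intro i hi hi'
        simp only [Finset.mem_Icc] at hi hi'
        rw [Finset.Icc_eq_empty (by omega), Finset.sum_empty]
    rw [key, key, key, h2, Finset.sum_congr rfl h3, Finset.sum_add_distrib, h4,
      Finset.sum_add_distrib, ← Finset.sum_mul, ← Finset.mul_sum]
    linear_combination ih

/-- The number of disjoint pairs of 2-sets in a window of replicas `1, …, k` that meet both the
first and the last replica of the window, sorted by the replicas that they use.  Replica `h`
provides `x h` elements for the first set and `y h` for the second one,
    of which `z h` are shared. -/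
noncomputable def windowCount (x y z : ℤ → ℕ) (k : ℤ) : ℕ :=
    (caseB (x 1) (y 1) (z 1) (y k) + caseB (y 1) (x 1) (z 1) (x k))
    + (caseB (x k) (y k) (z k) (y 1) + caseB (y k) (x k) (z k) (x 1))
    + (caseC (x 1) (y k) + caseC (y 1) (x k))
    + caseD (x 1) (y 1) (z 1) (x k) (y k) (z k)
    + (∑ h ∈ Finset.Icc 2 (k - 1), (caseE (x 1) (y h) (y k) + caseE (y 1) (x h) (x k)))
    + (∑ h ∈ Finset.Icc 2 (k - 1), (caseE (x h) (y 1) (y k) + caseE (y h) (x 1) (x k)))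
    + (∑ h ∈ Finset.Icc 2 (k - 1), (caseE (x k) (y 1) (y h) + caseE (y k) (x 1) (x h)))
    + (∑ h ∈ Finset.Icc 2 (k - 1),
        (caseG (x 1) (y 1) (z 1) (x h) (y k) + caseG (y 1) (x 1) (z 1) (y h) (x k)))
    + (∑ h ∈ Finset.Icc 2 (k - 1),
        (caseG (x h) (y h) (z h) (x 1) (y k) + caseG (y h) (x h) (z h) (y 1) (x k)))
    + (∑ h ∈ Finset.Icc 2 (k - 1),
        (caseG (x k) (y k) (z k) (x 1) (y h) + caseG (y k) (x k) (z k) (y 1) (x h)))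
    + (∑ h ∈ Finset.Icc 2 (k - 2), ∑ w ∈ Finset.Icc (h + 1) (k - 1),
        (caseI (x 1) (x h) (y w) (y k) + caseI (y 1) (y h) (x w) (x k)))
    + (∑ h ∈ Finset.Icc 2 (k - 2), ∑ w ∈ Finset.Icc (h + 1) (k - 1),
        (caseI (x 1) (x w) (y h) (y k) + caseI (y 1) (y w) (x h) (x k)))
    + (∑ h ∈ Finset.Icc 2 (k - 2), ∑ w ∈ Finset.Icc (h + 1) (k - 1),
        (caseI (x 1) (x k) (y h) (y w) + caseI (y 1) (y k) (x h) (x w)))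

/-- Inclusion-exclusion over the windows `1, …, k`, `2, …, k`, `1, …, k - 1`, `2, …, k - 1`. -/
theorem caseA_window (x y z : ℤ → ℕ) (hx : ∀ h, z h ≤ x h) (hy : ∀ h, z h ≤ y h)
    (k : ℤ) (hk : 2 ≤ k) :
    caseA (∑ h ∈ Finset.Icc 1 k, x h) (∑ h ∈ Finset.Icc 1 k, y h) (∑ h ∈ Finset.Icc 1 k, z h)
    + caseA (∑ h ∈ Finset.Icc 2 (k - 1), x h) (∑ h ∈ Finset.Icc 2 (k - 1), y h)
        (∑ h ∈ Finset.Icc 2 (k - 1), z h)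
    = caseA (∑ h ∈ Finset.Icc 2 k, x h) (∑ h ∈ Finset.Icc 2 k, y h) (∑ h ∈ Finset.Icc 2 k, z h)
    + caseA (∑ h ∈ Finset.Icc 1 (k - 1), x h) (∑ h ∈ Finset.Icc 1 (k - 1), y h)
        (∑ h ∈ Finset.Icc 1 (k - 1), z h)
    + windowCount x y z k := by
  unfold windowCount
  obtain ⟨n, rfl⟩ : ∃ n : ℕ, k = 2 + n := ⟨(k - 2).toNat, by omega⟩
  have hl : ∀ f : ℤ → ℕ, ∑ h ∈ Finset.Icc 1 ((2 : ℤ) + n - 1), f h =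
      f 1 + ∑ h ∈ Finset.Icc 2 ((2 : ℤ) + n - 1), f h := by
    intro f
    have : Finset.Icc 1 ((2 : ℤ) + n - 1) = insert 1 (Finset.Icc 2 ((2 : ℤ) + n - 1)) := by
      ext i; simp only [Finset.mem_Icc, Finset.mem_insert]; omega
    rw [this, Finset.sum_insert (by simp)]
  have hr : ∀ f : ℤ → ℕ, ∑ h ∈ Finset.Icc 2 ((2 : ℤ) + n), f h =
      f (2 + n) + ∑ h ∈ Finset.Icc 2 ((2 : ℤ) + n - 1), f h := by
    intro f
    have : Finset.Icc 2 ((2 : ℤ) + n) = insert (2 + n : ℤ) (Finset.Icc 2 ((2 : ℤ) + n - 1)) := by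
      ext i; simp only [Finset.mem_Icc, Finset.mem_insert]; omega
    rw [this, Finset.sum_insert (by simp)]
  have hlr : ∀ f : ℤ → ℕ, ∑ h ∈ Finset.Icc 1 ((2 : ℤ) + n), f h =
      f 1 + (f (2 + n) + ∑ h ∈ Finset.Icc 2 ((2 : ℤ) + n - 1), f h) := by
    intro f
    have : Finset.Icc 1 ((2 : ℤ) + n) = insert 1 (Finset.Icc 2 ((2 : ℤ) + n)) := by
      ext i; simp only [Finset.mem_Icc, Finset.mem_insert]; omega
    rw [this, Finset.sum_insert (by simp), hr]
  have hxx := sum_Icc_mul_sum_Icc (fun h => x h) (fun h => x h) 2 n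
  have hyy := sum_Icc_mul_sum_Icc (fun h => y h) (fun h => y h) 2 n
  have hxy := sum_Icc_mul_sum_Icc (fun h => x h) (fun h => y h) 2 n
  have hsx := Finset.sum_le_sum fun h (_ : h ∈ Finset.Icc 2 ((2 : ℤ) + n - 1)) => hx h
  have hsy := Finset.sum_le_sum fun h (_ : h ∈ Finset.Icc 2 ((2 : ℤ) + n - 1)) => hy h
  simp only [hl, hr, hlr]
  generalize (2 : ℤ) + n = k at *
  have hD : ∀ x y z x' y' z', caseD x y z x' y' z' = offDiagCount x y z * offDiagCount x' y' z' :=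
    fun _ _ _ _ _ _ => rfl
  have hG : ∀ x y z p q, caseG x y z p q = offDiagCount x y z * p * q := fun _ _ _ _ _ => rfl
  have q : ∀ a b : ℕ, (a : ℚ) = b → a = b := fun a b h => by exact_mod_cast h
  apply q
  push_cast [hD, hG, caseC, caseE, caseI, Nat.cast_choose_two]
  rw [cast_caseA, cast_caseA, cast_caseA, cast_caseA]
  · simp only [cast_caseB, cast_offDiagCount, hx, hy]
    push_cast
    -- Both sides become polynomials in the values at `1` and `k` and in ten interior sums. `lin`
    -- and `dbl` expand the sums of `windowCount` in terms of these.
    set X : ℚ := ∑ h ∈ Finset.Icc 2 (k - 1), (x h : ℚ) with h_X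
    set Y : ℚ := ∑ h ∈ Finset.Icc 2 (k - 1), (y h : ℚ) with h_Y
    set Z : ℚ := ∑ h ∈ Finset.Icc 2 (k - 1), (z h : ℚ) with h_Z
    set XX : ℚ := ∑ h ∈ Finset.Icc 2 (k - 1), (x h : ℚ) * x h with h_XX
    set YY : ℚ := ∑ h ∈ Finset.Icc 2 (k - 1), (y h : ℚ) * y h with h_YY
    set XY : ℚ := ∑ h ∈ Finset.Icc 2 (k - 1), (x h : ℚ) * y h with h_XY
    set DX : ℚ := ∑ h ∈ Finset.Icc 2 (k - 2), ∑ w ∈ Finset.Icc (h + 1) (k - 1), (x h : ℚ) * x w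
        with h_DX
    set DY : ℚ := ∑ h ∈ Finset.Icc 2 (k - 2), ∑ w ∈ Finset.Icc (h + 1) (k - 1), (y h : ℚ) * y w
        with h_DY
    set DXY : ℚ := ∑ h ∈ Finset.Icc 2 (k - 2), ∑ w ∈ Finset.Icc (h + 1) (k - 1), (x h : ℚ) * y w
        with h_DXY
    set DYX : ℚ := ∑ h ∈ Finset.Icc 2 (k - 2), ∑ w ∈ Finset.Icc (h + 1) (k - 1), (x w : ℚ) * y h
        with h_DYX
    have lin : ∀ (F : ℤ → ℚ) (a b c d e f : ℚ), (∀ h, F h = a * x h + b * y h + c * (x h * x h)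
        + d * (y h * y h) + e * (x h * y h) + f * z h) →
        ∑ h ∈ Finset.Icc 2 (k - 1), F h = a * X + b * Y + c * XX + d * YY + e * XY + f * Z := by
      intro F a b c d e f hF
      simp only [hF, Finset.sum_add_distrib, ← Finset.mul_sum, X, Y, XX, YY, XY, Z]
    have dbl : ∀ (F : ℤ → ℤ → ℚ) (a b c d : ℚ), (∀ h w, F h w = a * (x h * x w) + b * (y h * y w)
        + c * (x h * y w) + d * (x w * y h)) →
        ∑ h ∈ Finset.Icc 2 (k - 2), ∑ w ∈ Finset.Icc (h + 1) (k - 1), F h w =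
          a * DX + b * DY + c * DXY + d * DYX := by
      intro F a b c d hF
      simp only [hF, Finset.sum_add_distrib, ← Finset.mul_sum, DX, DY, DXY, DYX]
    have e1 := lin (fun h => (x 1 : ℚ) * ((x 1 : ℚ) - 1) / 2 * y h * y k + (y 1 : ℚ) *
        ((y 1 : ℚ) - 1) / 2 * x h * x k)
      ((y 1 : ℚ) * (y 1 - 1) / 2 * x k) ((x 1 : ℚ) * (x 1 - 1) / 2 * y k) (0) (0) (0) (0)
          (fun h => by ring)
    have e2 := lin (fun h => (x h : ℚ) * ((x h : ℚ) - 1) / 2 * y 1 * y k + (y h : ℚ) *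
        ((y h : ℚ) - 1) / 2 * x 1 * x k)
      (-((y 1 : ℚ) * y k) / 2) (-((x 1 : ℚ) * x k) / 2) ((y 1 : ℚ) * y k / 2) ((x 1 : ℚ) * x k / 2)
          (0) (0) (fun h => by ring)
    have e3 := lin (fun h => (x k : ℚ) * ((x k : ℚ) - 1) / 2 * y 1 * y h + (y k : ℚ) *
        ((y k : ℚ) - 1) / 2 * x 1 * x h)
      ((y k : ℚ) * (y k - 1) / 2 * x 1) ((x k : ℚ) * (x k - 1) / 2 * y 1) (0) (0) (0) (0)
          (fun h => by ring)
    have g1 := lin (fun h => ((x 1 : ℚ) * y 1 - z 1) * x h * y k +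
        ((y 1 : ℚ) * x 1 - z 1) * y h * x k)
      (((x 1 : ℚ) * y 1 - z 1) * y k) (((x 1 : ℚ) * y 1 - z 1) * x k) (0) (0) (0) (0)
          (fun h => by ring)
    have g2 := lin (fun h => ((x h : ℚ) * y h - z h) * x 1 * y k +
        ((y h : ℚ) * x h - z h) * y 1 * x k)
      (0) (0) (0) (0) ((x 1 : ℚ) * y k + y 1 * x k) (-((x 1 : ℚ) * y k + y 1 * x k))
          (fun h => by ring)
    have g3 := lin (fun h => ((x k : ℚ) * y k - z k) * x 1 * y h +
        ((y k : ℚ) * x k - z k) * y 1 * x h)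
      (((x k : ℚ) * y k - z k) * y 1) (((x k : ℚ) * y k - z k) * x 1) (0) (0) (0) (0)
          (fun h => by ring)
    have i1 := dbl (fun h w => (x 1 : ℚ) * x h * y w * y k + (y 1 : ℚ) * y h * x w * x k)
      (0) (0) ((x 1 : ℚ) * y k) ((y 1 : ℚ) * x k) (fun h w => by ring)
    have i2 := dbl (fun h w => (x 1 : ℚ) * x w * y h * y k + (y 1 : ℚ) * y w * x h * x k)
      (0) (0) ((y 1 : ℚ) * x k) ((x 1 : ℚ) * y k) (fun h w => by ring)
    have i3 := dbl (fun h w => (x 1 : ℚ) * x k * y h * y w + (y 1 : ℚ) * y k * x h * x w)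
      ((y 1 : ℚ) * y k) ((x 1 : ℚ) * x k) (0) (0) (fun h w => by ring)
    have hxx' := dbl (fun h w => (x h : ℚ) * x w + x w * x h) 2 0 0 0 (fun h w => by ring)
    have hyy' := dbl (fun h w => (y h : ℚ) * y w + y w * y h) 0 2 0 0 (fun h w => by ring)
    have hxy' := dbl (fun h w => (x h : ℚ) * y w + x w * y h) 0 0 1 1 (fun h w => by ring)
    rw [hxx'] at hxx
    rw [hyy'] at hyy
    rw [hxy'] at hxy
    rw [e1, e2, e3, g1, g2, g3, i1, i2, i3]
    -- Only products of two interior sums still need splitting. Their coefficients record the end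
    -- nodes: for two interior nodes of the first set, the second set takes one node at each end;
    -- for one interior node of each set, the remaining nodes occupy the two ends.
    linear_combination ((y 1 : ℚ) * y k / 2) * hxx + ((x 1 : ℚ) * x k / 2) * hyy
      + ((x 1 : ℚ) * y k + y 1 * x k) * hxy
  all_goals first
    | exact hsx | exact hsy
    | linarith [hx 1, hx k] | linarith [hy 1, hy k]

/-! ### Translating index ranges and folding ordered pairs -/

/-- Only the support of `F` contributes. By `hF` it lies in the given box and its translate by `d`
lies in the cube, so translation matches the nonzero terms of the two sums. -/
theorem sum_box_shift (F : ℤ → ℤ → ℤ → ℕ) (d a₁ b₁ a₂ b₂ a₃ b₃ B : ℤ)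
    (hF : ∀ i₁ i₂ i₃, F i₁ i₂ i₃ ≠ 0 → ((a₁ ≤ i₁ ∧ i₁ ≤ b₁) ∧ (a₂ ≤ i₂ ∧ i₂ ≤ b₂) ∧
      (a₃ ≤ i₃ ∧ i₃ ≤ b₃)) ∧ (0 ≤ i₁ + d ∧ i₁ + d ≤ B) ∧ (0 ≤ i₂ + d ∧ i₂ + d ≤ B) ∧
      (0 ≤ i₃ + d ∧ i₃ + d ≤ B)) :
    ∑ i₁ ∈ Finset.Icc a₁ b₁, ∑ i₂ ∈ Finset.Icc a₂ b₂, ∑ i₃ ∈ Finset.Icc a₃ b₃, F i₁ i₂ i₃ =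
    ∑ i₁ ∈ Finset.Icc 0 B, ∑ i₂ ∈ Finset.Icc 0 B, ∑ i₃ ∈ Finset.Icc 0 B,
      F (i₁ - d) (i₂ - d) (i₃ - d) := by
  simp only [← Finset.sum_product']
  refine Finset.sum_bij_ne_zero (fun p _ _ => (p.1 + d, p.2.1 + d, p.2.2 + d)) ?_ ?_ ?_ ?_
  · rintro ⟨i₁, i₂, i₃⟩ - h
    have := hF _ _ _ h
    simp only [Finset.mem_product, Finset.mem_Icc]
    exact this.2
  · rintro ⟨i₁, i₂, i₃⟩ - - ⟨j₁, j₂, j₃⟩ - - h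
    simpa using h
  · rintro ⟨i₁, i₂, i₃⟩ - h
    refine ⟨(i₁ - d, i₂ - d, i₃ - d), ?_, h, by simp⟩
    have := hF _ _ _ h
    simp only [Finset.mem_product, Finset.mem_Icc]
    exact this.1
  · rintro ⟨i₁, i₂, i₃⟩ - -
    simp

theorem emod_sub_ne_iff (i j d γ : ℤ) : (i - d) % γ ≠ (j - d) % γ ↔ i % γ ≠ j % γ := by
  rw [Ne, Ne, Int.emod_eq_emod_iff_emod_sub_eq_zero, sub_sub_sub_cancel_right,
    ← Int.emod_eq_emod_iff_emod_sub_eq_zero]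

theorem sumPairs_shift (γ d a₁ b₁ a b B : ℤ) (f g : ℤ → ℤ → ℤ → ℕ)
    (hf : ∀ i₁ i₂ i₃, f i₁ i₂ i₃ ≠ 0 → ((a₁ ≤ i₁ ∧ i₁ ≤ b₁) ∧ (a ≤ i₂ ∧ i₂ ≤ b) ∧
      (a ≤ i₃ ∧ i₃ ≤ b)) ∧ (0 ≤ i₁ + d ∧ i₁ + d ≤ B) ∧ (0 ≤ i₂ + d ∧ i₂ + d ≤ B) ∧
      (0 ≤ i₃ + d ∧ i₃ + d ≤ B))
    (hfg : ∀ i₁ i₂ i₃, f (i₁ - d) (i₂ - d) (i₃ - d) = g i₁ i₂ i₃) :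
    sumPairs γ a₁ b₁ a b f = sumPairs γ 0 B 0 B g := by
  unfold sumPairs
  rw [sum_box_shift _ d a₁ b₁ a b a b B]
  · simp only [emod_sub_ne_iff, hfg, sub_lt_sub_iff_right]
  · intro i₁ i₂ i₃ h
    exact hf _ _ _ fun h' => h (by simp [h'])

/-- The ordered pairs with `i₂ ≠ i₃` split into `i₂ < i₃` and `i₃ < i₂`. Renaming the indices in the
second half adds the summand `g'` with the roles of `i₂` and `i₃` exchanged. -/
theorem sumTriples_shift (γ d a₁ b₁ a₂ b₂ a₃ b₃ B : ℤ) (f g g' : ℤ → ℤ → ℤ → ℕ)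
    (hf : ∀ i₁ i₂ i₃, f i₁ i₂ i₃ ≠ 0 → ((a₁ ≤ i₁ ∧ i₁ ≤ b₁) ∧ (a₂ ≤ i₂ ∧ i₂ ≤ b₂) ∧
      (a₃ ≤ i₃ ∧ i₃ ≤ b₃)) ∧ (0 ≤ i₁ + d ∧ i₁ + d ≤ B) ∧ (0 ≤ i₂ + d ∧ i₂ + d ≤ B) ∧
      (0 ≤ i₃ + d ∧ i₃ + d ≤ B))
    (hfg : ∀ i₁ i₂ i₃, f (i₁ - d) (i₂ - d) (i₃ - d) = g i₁ i₂ i₃)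
    (hg : ∀ i₁ i₂ i₃, g i₁ i₃ i₂ = g' i₁ i₂ i₃) :
    sumTriples γ a₁ b₁ a₂ b₂ a₃ b₃ f =
      sumPairs γ 0 B 0 B (fun i₁ i₂ i₃ => g i₁ i₂ i₃ + g' i₁ i₂ i₃) := by
  simp only [← hg]
  unfold sumPairs sumTriples
  rw [sum_box_shift _ d a₁ b₁ a₂ b₂ a₃ b₃ B]
  · simp only [emod_sub_ne_iff, hfg, ne_eq, sub_left_inj]
    refine Finset.sum_congr rfl fun i₁ _ => ?_
    have h1 : ∀ i₂ i₃ : ℤ, (if ¬i₁ % γ = i₂ % γ ∧ ¬i₁ % γ = i₃ % γ ∧ ¬i₂ = i₃ then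
        g i₁ i₂ i₃ else 0) =
        (if ¬i₁ % γ = i₂ % γ ∧ ¬i₁ % γ = i₃ % γ ∧ i₂ < i₃ then g i₁ i₂ i₃ else 0) +
        (if ¬i₁ % γ = i₃ % γ ∧ ¬i₁ % γ = i₂ % γ ∧ i₃ < i₂ then g i₁ i₂ i₃ else 0) := by
      intro i₂ i₃
      rcases lt_trichotomy i₂ i₃ with h | h | h
      · simp [h, h.ne, h.not_gt]
      · simp [h]
      · simp only [h, h.ne', h.not_gt, not_false_eq_true, and_true, and_false, if_false, zero_add]
        simp only [and_comm]
    have h2 : ∀ i₂ i₃ : ℤ, (if ¬i₁ % γ = i₂ % γ ∧ ¬i₁ % γ = i₃ % γ ∧ i₂ < i₃ then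
        g i₁ i₂ i₃ + g i₁ i₃ i₂ else 0) =
        (if ¬i₁ % γ = i₂ % γ ∧ ¬i₁ % γ = i₃ % γ ∧ i₂ < i₃ then g i₁ i₂ i₃ else 0) +
        (if ¬i₁ % γ = i₂ % γ ∧ ¬i₁ % γ = i₃ % γ ∧ i₂ < i₃ then g i₁ i₃ i₂ else 0) := by
      intro i₂ i₃
      split_ifs <;> simp
    simp only [h1, h2, Finset.sum_add_distrib]
    congr 1
    exact Finset.sum_comm
  · intro i₁ i₂ i₃ h
    exact hf _ _ _ fun h' => h (by simp [h'])

theorem sumPairs_add (γ a₁ b₁ a b : ℤ) (f g : ℤ → ℤ → ℤ → ℕ) :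
    sumPairs γ a₁ b₁ a b (fun i₁ i₂ i₃ => f i₁ i₂ i₃ + g i₁ i₂ i₃) =
      sumPairs γ a₁ b₁ a b f + sumPairs γ a₁ b₁ a b g := by
  simp only [sumPairs, ← Finset.sum_add_distrib, ← ite_add_zero]

theorem sumPairs_sum {ι : Type*} (s : Finset ι) (γ a₁ b₁ a b : ℤ) (f : ι → ℤ → ℤ → ℤ → ℕ) :
    sumPairs γ a₁ b₁ a b (fun i₁ i₂ i₃ => ∑ h ∈ s, f h i₁ i₂ i₃) =
      ∑ h ∈ s, sumPairs γ a₁ b₁ a b (f h) := by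
  classical
  induction s using Finset.induction_on with
  | empty => simp [sumPairs]
  | insert h s hs ih => simp only [Finset.sum_insert hs, sumPairs_add, ih]

/-- This and its analogues below locate the support: a nonzero term has nonzero overlaps, and a
nonzero overlap forces its row indices into the stacked matrix. -/
theorem caseA_ne_zero {x y z : ℕ} (hx : z ≤ x) (hy : z ≤ y) (h : caseA x y z ≠ 0) :
    x ≠ 0 ∧ y ≠ 0 := by
  constructor <;> rintro rfl <;> apply h
  · obtain rfl := Nat.le_zero.1 hx
    simp [caseA]
  · obtain rfl := Nat.le_zero.1 hy
    simp [caseA]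

theorem caseB_ne_zero {x y z p : ℕ} (hx : z ≤ x) (hy : z ≤ y) (h : caseB x y z p ≠ 0) :
    x ≠ 0 ∧ y ≠ 0 ∧ p ≠ 0 := by
  refine ⟨?_, ?_, ?_⟩ <;> rintro rfl <;> apply h
  · obtain rfl := Nat.le_zero.1 hx
    simp [caseB]
  · obtain rfl := Nat.le_zero.1 hy
    simp [caseB]
  · simp [caseB]

theorem offDiagCount_ne_zero {x y z : ℕ} (hx : z ≤ x) (h : offDiagCount x y z ≠ 0) :
    x ≠ 0 ∧ y ≠ 0 := by
  constructor <;> rintro rfl <;> apply h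
  · obtain rfl := Nat.le_zero.1 hx
    simp [offDiagCount]
  · simp [offDiagCount]

theorem caseC_ne_zero {x p : ℕ} (h : caseC x p ≠ 0) : x ≠ 0 ∧ p ≠ 0 := by
  constructor <;> rintro rfl <;> simp [caseC] at h

theorem caseD_ne_zero {x y z x' y' z' : ℕ} (hx : z ≤ x) (hx' : z' ≤ x')
    (h : caseD x y z x' y' z' ≠ 0) : x ≠ 0 ∧ y ≠ 0 ∧ x' ≠ 0 ∧ y' ≠ 0 := by
  have h' := mul_ne_zero_iff.1 h
  have h1 := offDiagCount_ne_zero hx h'.1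
  have h2 := offDiagCount_ne_zero hx' h'.2
  exact ⟨h1.1, h1.2, h2⟩

theorem caseE_ne_zero {x p q : ℕ} (h : caseE x p q ≠ 0) : x ≠ 0 ∧ p ≠ 0 ∧ q ≠ 0 := by
  refine ⟨?_, ?_, ?_⟩ <;> rintro rfl <;> simp [caseE] at h

theorem caseG_ne_zero {x y z p q : ℕ} (hx : z ≤ x) (h : caseG x y z p q ≠ 0) :
    x ≠ 0 ∧ y ≠ 0 ∧ p ≠ 0 ∧ q ≠ 0 := by
  have h' := mul_ne_zero_iff.1 h
  have h'' := mul_ne_zero_iff.1 h'.1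
  have h1 := offDiagCount_ne_zero hx h''.1
  exact ⟨h1.1, h1.2, h''.2, h'.2⟩

theorem caseI_ne_zero {x p q r : ℕ} (h : caseI x p q r ≠ 0) :
    x ≠ 0 ∧ p ≠ 0 ∧ q ≠ 0 ∧ r ≠ 0 := by
  refine ⟨?_, ?_, ?_, ?_⟩ <;> rintro rfl <;> simp [caseI] at h

/-! ### Matching the closed formula with the window count -/

/-- The overlap of the rows `i` and `j` in the `h`-th replica after the first `a` ones. -/
def pairOverlap (γ a : ℤ) (t : Finset ℤ → ℕ) (i j h : ℤ) : ℕ :=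
  t {i - (a + h - 1) * γ, j - (a + h - 1) * γ}

/-- The overlap of the rows `i`, `j` and `l` in the `h`-th replica after the first `a` ones. -/
def tripleOverlap (γ a : ℤ) (t : Finset ℤ → ℕ) (i j l h : ℤ) : ℕ :=
  t {i - (a + h - 1) * γ, j - (a + h - 1) * γ, l - (a + h - 1) * γ}

theorem tripleOverlap_comm (γ a : ℤ) (t : Finset ℤ → ℕ) (i j l : ℤ) :
    tripleOverlap γ a t i l j = tripleOverlap γ a t i j l := by
  funext h
  rw [tripleOverlap, tripleOverlap, Finset.pair_comm]

section

variable {γ m : ℤ} {t : Finset ℤ → ℕ}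

theorem pair_bounds (ht : ∀ s, t s ≠ 0 → ∀ i ∈ s, 0 ≤ i ∧ i ≤ (m + 1) * γ - 1) {i j : ℤ}
    (h : t {i, j} ≠ 0) : (0 ≤ i ∧ i ≤ (m + 1) * γ - 1) ∧ (0 ≤ j ∧ j ≤ (m + 1) * γ - 1) :=
  ⟨ht _ h i (by simp), ht _ h j (by simp)⟩

theorem triple_le_left (hmono : Antitone t) (i j l : ℤ) : t {i, j, l} ≤ t {i, j} :=
  hmono (by intro u; simp; tauto)

theorem triple_le_right (hmono : Antitone t) (i j l : ℤ) : t {i, j, l} ≤ t {i, l} :=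
  hmono (by intro u; simp; tauto)

theorem formula1_eq (ht : ∀ s, t s ≠ 0 → ∀ i ∈ s, 0 ≤ i ∧ i ≤ (m + 1) * γ - 1)
    (hmono : Antitone t) (hγ : 1 ≤ γ) {a B : ℤ} (ha : 0 ≤ a) (hB : (a + 1 + m) * γ - 1 ≤ B) :
    formula1 γ m t = sumPairs γ 0 B 0 B (fun i₁ i₂ i₃ =>
      caseA (pairOverlap γ a t i₁ i₂ 1) (pairOverlap γ a t i₁ i₃ 1)
        (tripleOverlap γ a t i₁ i₂ i₃ 1)) := by
  have haγ : 0 ≤ a * γ := by positivity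
  refine sumPairs_shift γ (a * γ) _ _ _ _ B _ _ ?_ ?_
  · intro i₁ i₂ i₃ h
    obtain ⟨h1, h2⟩ := caseA_ne_zero (triple_le_left hmono _ _ _) (triple_le_right hmono _ _ _) h
    obtain ⟨⟨p1, p2⟩, p3, p4⟩ := pair_bounds ht h1
    obtain ⟨⟨p5, p6⟩, p7, p8⟩ := pair_bounds ht h2
    refine ⟨⟨⟨?_, ?_⟩, ⟨?_, ?_⟩, ⟨?_, ?_⟩⟩, ⟨?_, ?_⟩, ⟨?_, ?_⟩, ⟨?_, ?_⟩⟩ <;> linarith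
  · intro i₁ i₂ i₃
    simp only [pairOverlap, tripleOverlap, add_sub_cancel_right]

/-- In this and the following lemmas the formula measures rows from the replica whose overlap is
unshifted. The translation is `a * γ`, `(a + h - 1) * γ` or `(a + k - 1) * γ` according to whether
that replica is the first, the `h`-th or the last of the window. The ranges follow linearly from the
bounds on the rows of the nonzero overlaps, once products such as `k * γ` count as unknowns and
their order is supplied. -/
theorem sumTriples_caseB_first (ht : ∀ s, t s ≠ 0 → ∀ i ∈ s, 0 ≤ i ∧ i ≤ (m + 1) * γ - 1)
    (hmono : Antitone t) (hγ : 1 ≤ γ) {a k B : ℤ} (ha : 0 ≤ a) (hk : 2 ≤ k)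
    (hB : (a + k + m) * γ - 1 ≤ B) :
    sumTriples γ ((k - 1) * γ) ((m + 1) * γ - 1) 0 ((m + 1) * γ - 1) ((k - 1) * γ) ((m +
        1) * γ - 1) (fun i₁ i₂ i₃ =>
      caseB (t {i₁, i₂}) (t {i₁, i₃}) (t {i₁, i₂, i₃}) (t {i₁ + (1 - k) * γ, i₃ + (1 - k) * γ})) =
    sumPairs γ 0 B 0 B (fun i₁ i₂ i₃ =>
      caseB (pairOverlap γ a t i₁ i₂ 1) (pairOverlap γ a t i₁ i₃ 1)
          (tripleOverlap γ a t i₁ i₂ i₃ 1) (pairOverlap γ a t i₁ i₃ k) +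
        caseB (pairOverlap γ a t i₁ i₃ 1) (pairOverlap γ a t i₁ i₂ 1)
            (tripleOverlap γ a t i₁ i₂ i₃ 1) (pairOverlap γ a t i₁ i₂ k)) := by
  have haγ : 0 ≤ a * γ := by positivity
  have hkγ : 0 ≤ (k - 1) * γ := mul_nonneg (by linarith) (by linarith)
  refine sumTriples_shift γ (a * γ) _ _ _ _ _ _ B _ (fun i₁ i₂ i₃ =>
      caseB (pairOverlap γ a t i₁ i₂ 1) (pairOverlap γ a t i₁ i₃ 1)
          (tripleOverlap γ a t i₁ i₂ i₃ 1) (pairOverlap γ a t i₁ i₃ k)) _ ?_ ?_ ?_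
  · intro i₁ i₂ i₃ h0
    obtain ⟨n1, n2, n3⟩ := caseB_ne_zero (triple_le_left hmono _ _ _)
        (triple_le_right hmono _ _ _) h0
    obtain ⟨⟨p1, q1⟩, r1, s1⟩ := pair_bounds ht n1
    obtain ⟨⟨p2, q2⟩, r2, s2⟩ := pair_bounds ht n2
    obtain ⟨⟨p3, q3⟩, r3, s3⟩ := pair_bounds ht n3
    refine ⟨⟨⟨?_, ?_⟩, ⟨?_, ?_⟩, ⟨?_, ?_⟩⟩, ⟨?_, ?_⟩, ⟨?_, ?_⟩, ⟨?_, ?_⟩⟩ <;> linarith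
  · intro i₁ i₂ i₃
    simp only [pairOverlap, tripleOverlap]
    ring_nf
  · intro i₁ i₂ i₃
    simp only [tripleOverlap_comm γ a t i₁ i₂ i₃]

theorem sumTriples_caseB_last (ht : ∀ s, t s ≠ 0 → ∀ i ∈ s, 0 ≤ i ∧ i ≤ (m + 1) * γ - 1)
    (hmono : Antitone t) (hγ : 1 ≤ γ) {a k B : ℤ} (ha : 0 ≤ a) (hk : 2 ≤ k)
    (hB : (a + k + m) * γ - 1 ≤ B) :
    sumTriples γ 0 ((m - k + 2) * γ - 1) 0 ((m + 1) * γ - 1) 0 ((m - k + 2) * γ - 1)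
        (fun i₁ i₂ i₃ =>
      caseB (t {i₁, i₂}) (t {i₁, i₃}) (t {i₁, i₂, i₃}) (t {i₁ + (k - 1) * γ, i₃ + (k - 1) * γ})) =
    sumPairs γ 0 B 0 B (fun i₁ i₂ i₃ =>
      caseB (pairOverlap γ a t i₁ i₂ k) (pairOverlap γ a t i₁ i₃ k)
          (tripleOverlap γ a t i₁ i₂ i₃ k) (pairOverlap γ a t i₁ i₃ 1) +
        caseB (pairOverlap γ a t i₁ i₃ k) (pairOverlap γ a t i₁ i₂ k)
            (tripleOverlap γ a t i₁ i₂ i₃ k) (pairOverlap γ a t i₁ i₂ 1)) := by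
  have haγ : 0 ≤ a * γ := by positivity
  have hkγ : 0 ≤ (k - 1) * γ := mul_nonneg (by linarith) (by linarith)
  refine sumTriples_shift γ ((a + k - 1) * γ) _ _ _ _ _ _ B _ (fun i₁ i₂ i₃ =>
      caseB (pairOverlap γ a t i₁ i₂ k) (pairOverlap γ a t i₁ i₃ k)
          (tripleOverlap γ a t i₁ i₂ i₃ k) (pairOverlap γ a t i₁ i₃ 1)) _ ?_ ?_ ?_
  · intro i₁ i₂ i₃ h0
    obtain ⟨n1, n2, n3⟩ := caseB_ne_zero (triple_le_left hmono _ _ _)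
        (triple_le_right hmono _ _ _) h0
    obtain ⟨⟨p1, q1⟩, r1, s1⟩ := pair_bounds ht n1
    obtain ⟨⟨p2, q2⟩, r2, s2⟩ := pair_bounds ht n2
    obtain ⟨⟨p3, q3⟩, r3, s3⟩ := pair_bounds ht n3
    refine ⟨⟨⟨?_, ?_⟩, ⟨?_, ?_⟩, ⟨?_, ?_⟩⟩, ⟨?_, ?_⟩, ⟨?_, ?_⟩, ⟨?_, ?_⟩⟩ <;> linarith
  · intro i₁ i₂ i₃
    simp only [pairOverlap, tripleOverlap]
    ring_nf
  · intro i₁ i₂ i₃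
    simp only [tripleOverlap_comm γ a t i₁ i₂ i₃]

/-- Here `i₃` occurs only in a shifted overlap, so it may exceed the rows of the stacked matrix;
hence the upper end `(m + k) * γ - 1`. -/
theorem sumTriples_caseC (ht : ∀ s, t s ≠ 0 → ∀ i ∈ s, 0 ≤ i ∧ i ≤ (m + 1) * γ - 1)
    (hγ : 1 ≤ γ) {a k B : ℤ} (ha : 0 ≤ a) (hk : 2 ≤ k)
    (hB : (a + k + m) * γ - 1 ≤ B) :
    sumTriples γ ((k - 1) * γ) ((m + 1) * γ - 1) 0 ((m + 1) * γ - 1) ((k - 1) * γ) ((m +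
        k) * γ - 1) (fun i₁ i₂ i₃ =>
      caseC (t {i₁, i₂}) (t {i₁ + (1 - k) * γ, i₃ + (1 - k) * γ})) =
    sumPairs γ 0 B 0 B (fun i₁ i₂ i₃ =>
      caseC (pairOverlap γ a t i₁ i₂ 1) (pairOverlap γ a t i₁ i₃ k) +
        caseC (pairOverlap γ a t i₁ i₃ 1) (pairOverlap γ a t i₁ i₂ k)) := by
  have haγ : 0 ≤ a * γ := by positivity
  have hkγ : 0 ≤ (k - 1) * γ := mul_nonneg (by linarith) (by linarith)
  refine sumTriples_shift γ (a * γ) _ _ _ _ _ _ B _ (fun i₁ i₂ i₃ =>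
      caseC (pairOverlap γ a t i₁ i₂ 1) (pairOverlap γ a t i₁ i₃ k)) _ ?_ ?_ ?_
  · intro i₁ i₂ i₃ h0
    obtain ⟨n1, n2⟩ := caseC_ne_zero h0
    obtain ⟨⟨p1, q1⟩, r1, s1⟩ := pair_bounds ht n1
    obtain ⟨⟨p2, q2⟩, r2, s2⟩ := pair_bounds ht n2
    refine ⟨⟨⟨?_, ?_⟩, ⟨?_, ?_⟩, ⟨?_, ?_⟩⟩, ⟨?_, ?_⟩, ⟨?_, ?_⟩, ⟨?_, ?_⟩⟩ <;> linarith
  · intro i₁ i₂ i₃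
    simp only [pairOverlap]
    ring_nf
  · intro i₁ i₂ i₃
    rfl

theorem sumTriples_caseE_first (ht : ∀ s, t s ≠ 0 → ∀ i ∈ s, 0 ≤ i ∧ i ≤ (m + 1) * γ - 1)
    (hγ : 1 ≤ γ) {a k B : ℤ} (ha : 0 ≤ a)
    (hB : (a + k + m) * γ - 1 ≤ B) {h : ℤ} (h2 : 2 ≤ h) (hhk : h ≤ k - 1) :
    sumTriples γ ((k - 1) * γ) ((m + 1) * γ - 1) 0 ((m + 1) * γ - 1) ((k - 1) * γ) ((m +
        h) * γ - 1) (fun i₁ i₂ i₃ =>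
      caseE (t {i₁, i₂}) (t {i₁ + (1 - h) * γ, i₃ + (1 - h) * γ}) (t {i₁ + (1 - k) * γ, i₃ +
          (1 - k) * γ})) =
    sumPairs γ 0 B 0 B (fun i₁ i₂ i₃ =>
      caseE (pairOverlap γ a t i₁ i₂ 1) (pairOverlap γ a t i₁ i₃ h) (pairOverlap γ a t i₁ i₃ k) +
        caseE (pairOverlap γ a t i₁ i₃ 1) (pairOverlap γ a t i₁ i₂ h)
            (pairOverlap γ a t i₁ i₂ k)) := by
  have haγ : 0 ≤ a * γ := by positivity
  have hkγ : 0 ≤ (k - 1) * γ := mul_nonneg (by linarith) (by linarith)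
  have hhγ : 0 ≤ (h - 1) * γ := mul_nonneg (by linarith) (by linarith)
  have hkhγ : 0 ≤ (k - h) * γ := mul_nonneg (by linarith) (by linarith)
  refine sumTriples_shift γ (a * γ) _ _ _ _ _ _ B _ (fun i₁ i₂ i₃ =>
      caseE (pairOverlap γ a t i₁ i₂ 1) (pairOverlap γ a t i₁ i₃ h)
          (pairOverlap γ a t i₁ i₃ k)) _ ?_ ?_ ?_
  · intro i₁ i₂ i₃ h0
    obtain ⟨n1, n2, n3⟩ := caseE_ne_zero h0
    obtain ⟨⟨p1, q1⟩, r1, s1⟩ := pair_bounds ht n1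
    obtain ⟨⟨p2, q2⟩, r2, s2⟩ := pair_bounds ht n2
    obtain ⟨⟨p3, q3⟩, r3, s3⟩ := pair_bounds ht n3
    refine ⟨⟨⟨?_, ?_⟩, ⟨?_, ?_⟩, ⟨?_, ?_⟩⟩, ⟨?_, ?_⟩, ⟨?_, ?_⟩, ⟨?_, ?_⟩⟩ <;> linarith
  · intro i₁ i₂ i₃
    simp only [pairOverlap]
    ring_nf
  · intro i₁ i₂ i₃
    rfl

theorem sumTriples_caseE_middle (ht : ∀ s, t s ≠ 0 → ∀ i ∈ s, 0 ≤ i ∧ i ≤ (m + 1) * γ - 1)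
    (hγ : 1 ≤ γ) {a k B : ℤ} (ha : 0 ≤ a)
    (hB : (a + k + m) * γ - 1 ≤ B) {h : ℤ} (h2 : 2 ≤ h) (hhk : h ≤ k - 1) :
    sumTriples γ ((k - h) * γ) ((m - h + 2) * γ - 1) 0 ((m + 1) * γ - 1) ((k - h) * γ) ((m - h +
        2) * γ - 1) (fun i₁ i₂ i₃ =>
      caseE (t {i₁, i₂}) (t {i₁ + (h - 1) * γ, i₃ + (h - 1) * γ}) (t {i₁ + (h - k) * γ, i₃ +
          (h - k) * γ})) =
    sumPairs γ 0 B 0 B (fun i₁ i₂ i₃ =>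
      caseE (pairOverlap γ a t i₁ i₂ h) (pairOverlap γ a t i₁ i₃ 1) (pairOverlap γ a t i₁ i₃ k) +
        caseE (pairOverlap γ a t i₁ i₃ h) (pairOverlap γ a t i₁ i₂ 1)
            (pairOverlap γ a t i₁ i₂ k)) := by
  have haγ : 0 ≤ a * γ := by positivity
  have hkγ : 0 ≤ (k - 1) * γ := mul_nonneg (by linarith) (by linarith)
  have hhγ : 0 ≤ (h - 1) * γ := mul_nonneg (by linarith) (by linarith)
  have hkhγ : 0 ≤ (k - h) * γ := mul_nonneg (by linarith) (by linarith)
  refine sumTriples_shift γ ((a + h - 1) * γ) _ _ _ _ _ _ B _ (fun i₁ i₂ i₃ =>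
      caseE (pairOverlap γ a t i₁ i₂ h) (pairOverlap γ a t i₁ i₃ 1)
          (pairOverlap γ a t i₁ i₃ k)) _ ?_ ?_ ?_
  · intro i₁ i₂ i₃ h0
    obtain ⟨n1, n2, n3⟩ := caseE_ne_zero h0
    obtain ⟨⟨p1, q1⟩, r1, s1⟩ := pair_bounds ht n1
    obtain ⟨⟨p2, q2⟩, r2, s2⟩ := pair_bounds ht n2
    obtain ⟨⟨p3, q3⟩, r3, s3⟩ := pair_bounds ht n3
    refine ⟨⟨⟨?_, ?_⟩, ⟨?_, ?_⟩, ⟨?_, ?_⟩⟩, ⟨?_, ?_⟩, ⟨?_, ?_⟩, ⟨?_, ?_⟩⟩ <;> linarith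
  · intro i₁ i₂ i₃
    simp only [pairOverlap]
    ring_nf
  · intro i₁ i₂ i₃
    rfl

/-- The row `i₃` is used only after a shift upwards by at least `(k - h) * γ`, so negative values
down to `(h - k) * γ` occur. -/
theorem sumTriples_caseE_last (ht : ∀ s, t s ≠ 0 → ∀ i ∈ s, 0 ≤ i ∧ i ≤ (m + 1) * γ - 1)
    (hγ : 1 ≤ γ) {a k B : ℤ} (ha : 0 ≤ a)
    (hB : (a + k + m) * γ - 1 ≤ B) {h : ℤ} (h2 : 2 ≤ h) (hhk : h ≤ k - 1) :
    sumTriples γ 0 ((m - k + 2) * γ - 1) 0 ((m + 1) * γ - 1) ((h - k) * γ) ((m - k + 2) * γ - 1)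
        (fun i₁ i₂ i₃ =>
      caseE (t {i₁, i₂}) (t {i₁ + (k - 1) * γ, i₃ + (k - 1) * γ}) (t {i₁ + (k - h) * γ, i₃ +
          (k - h) * γ})) =
    sumPairs γ 0 B 0 B (fun i₁ i₂ i₃ =>
      caseE (pairOverlap γ a t i₁ i₂ k) (pairOverlap γ a t i₁ i₃ 1) (pairOverlap γ a t i₁ i₃ h) +
        caseE (pairOverlap γ a t i₁ i₃ k) (pairOverlap γ a t i₁ i₂ 1)
            (pairOverlap γ a t i₁ i₂ h)) := by
  have haγ : 0 ≤ a * γ := by positivity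
  have hkγ : 0 ≤ (k - 1) * γ := mul_nonneg (by linarith) (by linarith)
  have hhγ : 0 ≤ (h - 1) * γ := mul_nonneg (by linarith) (by linarith)
  have hkhγ : 0 ≤ (k - h) * γ := mul_nonneg (by linarith) (by linarith)
  refine sumTriples_shift γ ((a + k - 1) * γ) _ _ _ _ _ _ B _ (fun i₁ i₂ i₃ =>
      caseE (pairOverlap γ a t i₁ i₂ k) (pairOverlap γ a t i₁ i₃ 1)
          (pairOverlap γ a t i₁ i₃ h)) _ ?_ ?_ ?_
  · intro i₁ i₂ i₃ h0
    obtain ⟨n1, n2, n3⟩ := caseE_ne_zero h0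
    obtain ⟨⟨p1, q1⟩, r1, s1⟩ := pair_bounds ht n1
    obtain ⟨⟨p2, q2⟩, r2, s2⟩ := pair_bounds ht n2
    obtain ⟨⟨p3, q3⟩, r3, s3⟩ := pair_bounds ht n3
    refine ⟨⟨⟨?_, ?_⟩, ⟨?_, ?_⟩, ⟨?_, ?_⟩⟩, ⟨?_, ?_⟩, ⟨?_, ?_⟩, ⟨?_, ?_⟩⟩ <;> linarith
  · intro i₁ i₂ i₃
    simp only [pairOverlap]
    ring_nf
  · intro i₁ i₂ i₃
    rfl

/-- One replica holds a node of each 2-set. These two nodes must differ, which is why the triple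
overlap enters for that replica alone. -/
theorem sumTriples_caseG_first (ht : ∀ s, t s ≠ 0 → ∀ i ∈ s, 0 ≤ i ∧ i ≤ (m + 1) * γ - 1)
    (hmono : Antitone t) (hγ : 1 ≤ γ) {a k B : ℤ} (ha : 0 ≤ a)
    (hB : (a + k + m) * γ - 1 ≤ B) {h : ℤ} (h2 : 2 ≤ h) (hhk : h ≤ k - 1) :
    sumTriples γ ((k - 1) * γ) ((m + 1) * γ - 1) ((h - 1) * γ) ((m + 1) * γ - 1) ((k - 1) * γ)
        ((m + 1) * γ - 1) (fun i₁ i₂ i₃ =>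
      caseG (t {i₁, i₂}) (t {i₁, i₃}) (t {i₁, i₂, i₃}) (t {i₁ + (1 - h) * γ, i₂ + (1 - h) * γ})
          (t {i₁ + (1 - k) * γ, i₃ + (1 - k) * γ})) =
    sumPairs γ 0 B 0 B (fun i₁ i₂ i₃ =>
      caseG (pairOverlap γ a t i₁ i₂ 1) (pairOverlap γ a t i₁ i₃ 1)
          (tripleOverlap γ a t i₁ i₂ i₃ 1) (pairOverlap γ a t i₁ i₂ h) (pairOverlap γ a t i₁ i₃ k) +
        caseG (pairOverlap γ a t i₁ i₃ 1) (pairOverlap γ a t i₁ i₂ 1)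
            (tripleOverlap γ a t i₁ i₂ i₃ 1) (pairOverlap γ a t i₁ i₃ h)
            (pairOverlap γ a t i₁ i₂ k)) := by
  have haγ : 0 ≤ a * γ := by positivity
  have hkγ : 0 ≤ (k - 1) * γ := mul_nonneg (by linarith) (by linarith)
  have hhγ : 0 ≤ (h - 1) * γ := mul_nonneg (by linarith) (by linarith)
  have hkhγ : 0 ≤ (k - h) * γ := mul_nonneg (by linarith) (by linarith)
  refine sumTriples_shift γ (a * γ) _ _ _ _ _ _ B _ (fun i₁ i₂ i₃ =>
      caseG (pairOverlap γ a t i₁ i₂ 1) (pairOverlap γ a t i₁ i₃ 1)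
          (tripleOverlap γ a t i₁ i₂ i₃ 1) (pairOverlap γ a t i₁ i₂ h)
          (pairOverlap γ a t i₁ i₃ k)) _ ?_ ?_ ?_
  · intro i₁ i₂ i₃ h0
    obtain ⟨n1, n2, n3, n4⟩ := caseG_ne_zero (triple_le_left hmono _ _ _) h0
    obtain ⟨⟨p1, q1⟩, r1, s1⟩ := pair_bounds ht n1
    obtain ⟨⟨p2, q2⟩, r2, s2⟩ := pair_bounds ht n2
    obtain ⟨⟨p3, q3⟩, r3, s3⟩ := pair_bounds ht n3
    obtain ⟨⟨p4, q4⟩, r4, s4⟩ := pair_bounds ht n4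
    refine ⟨⟨⟨?_, ?_⟩, ⟨?_, ?_⟩, ⟨?_, ?_⟩⟩, ⟨?_, ?_⟩, ⟨?_, ?_⟩, ⟨?_, ?_⟩⟩ <;> linarith
  · intro i₁ i₂ i₃
    simp only [pairOverlap, tripleOverlap]
    ring_nf
  · intro i₁ i₂ i₃
    simp only [tripleOverlap_comm γ a t i₁ i₂ i₃]

theorem sumTriples_caseG_middle (ht : ∀ s, t s ≠ 0 → ∀ i ∈ s, 0 ≤ i ∧ i ≤ (m + 1) * γ - 1)
    (hmono : Antitone t) (hγ : 1 ≤ γ) {a k B : ℤ} (ha : 0 ≤ a)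
    (hB : (a + k + m) * γ - 1 ≤ B) {h : ℤ} (h2 : 2 ≤ h) (hhk : h ≤ k - 1) :
    sumTriples γ ((k - h) * γ) ((m - h + 2) * γ - 1) 0 ((m - h + 2) * γ - 1) ((k - h) * γ) ((m +
        1) * γ - 1) (fun i₁ i₂ i₃ =>
      caseG (t {i₁, i₂}) (t {i₁, i₃}) (t {i₁, i₂, i₃}) (t {i₁ + (h - 1) * γ, i₂ + (h - 1) * γ})
          (t {i₁ + (h - k) * γ, i₃ + (h - k) * γ})) =
    sumPairs γ 0 B 0 B (fun i₁ i₂ i₃ =>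
      caseG (pairOverlap γ a t i₁ i₂ h) (pairOverlap γ a t i₁ i₃ h)
          (tripleOverlap γ a t i₁ i₂ i₃ h) (pairOverlap γ a t i₁ i₂ 1) (pairOverlap γ a t i₁ i₃ k) +
        caseG (pairOverlap γ a t i₁ i₃ h) (pairOverlap γ a t i₁ i₂ h)
            (tripleOverlap γ a t i₁ i₂ i₃ h) (pairOverlap γ a t i₁ i₃ 1)
            (pairOverlap γ a t i₁ i₂ k)) := by
  have haγ : 0 ≤ a * γ := by positivity
  have hkγ : 0 ≤ (k - 1) * γ := mul_nonneg (by linarith) (by linarith)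
  have hhγ : 0 ≤ (h - 1) * γ := mul_nonneg (by linarith) (by linarith)
  have hkhγ : 0 ≤ (k - h) * γ := mul_nonneg (by linarith) (by linarith)
  refine sumTriples_shift γ ((a + h - 1) * γ) _ _ _ _ _ _ B _ (fun i₁ i₂ i₃ =>
      caseG (pairOverlap γ a t i₁ i₂ h) (pairOverlap γ a t i₁ i₃ h)
          (tripleOverlap γ a t i₁ i₂ i₃ h) (pairOverlap γ a t i₁ i₂ 1)
          (pairOverlap γ a t i₁ i₃ k)) _ ?_ ?_ ?_
  · intro i₁ i₂ i₃ h0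
    obtain ⟨n1, n2, n3, n4⟩ := caseG_ne_zero (triple_le_left hmono _ _ _) h0
    obtain ⟨⟨p1, q1⟩, r1, s1⟩ := pair_bounds ht n1
    obtain ⟨⟨p2, q2⟩, r2, s2⟩ := pair_bounds ht n2
    obtain ⟨⟨p3, q3⟩, r3, s3⟩ := pair_bounds ht n3
    obtain ⟨⟨p4, q4⟩, r4, s4⟩ := pair_bounds ht n4
    refine ⟨⟨⟨?_, ?_⟩, ⟨?_, ?_⟩, ⟨?_, ?_⟩⟩, ⟨?_, ?_⟩, ⟨?_, ?_⟩, ⟨?_, ?_⟩⟩ <;> linarith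
  · intro i₁ i₂ i₃
    simp only [pairOverlap, tripleOverlap]
    ring_nf
  · intro i₁ i₂ i₃
    simp only [tripleOverlap_comm γ a t i₁ i₂ i₃]

theorem sumTriples_caseG_last (ht : ∀ s, t s ≠ 0 → ∀ i ∈ s, 0 ≤ i ∧ i ≤ (m + 1) * γ - 1)
    (hmono : Antitone t) (hγ : 1 ≤ γ) {a k B : ℤ} (ha : 0 ≤ a)
    (hB : (a + k + m) * γ - 1 ≤ B) {h : ℤ} (h2 : 2 ≤ h) (hhk : h ≤ k - 1) :
    sumTriples γ 0 ((m - k + 2) * γ - 1) 0 ((m - k + 2) * γ - 1) 0 ((m - k + h + 1) * γ - 1)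
        (fun i₁ i₂ i₃ =>
      caseG (t {i₁, i₂}) (t {i₁, i₃}) (t {i₁, i₂, i₃}) (t {i₁ + (k - 1) * γ, i₂ + (k - 1) * γ})
          (t {i₁ + (k - h) * γ, i₃ + (k - h) * γ})) =
    sumPairs γ 0 B 0 B (fun i₁ i₂ i₃ =>
      caseG (pairOverlap γ a t i₁ i₂ k) (pairOverlap γ a t i₁ i₃ k)
          (tripleOverlap γ a t i₁ i₂ i₃ k) (pairOverlap γ a t i₁ i₂ 1) (pairOverlap γ a t i₁ i₃ h) +
        caseG (pairOverlap γ a t i₁ i₃ k) (pairOverlap γ a t i₁ i₂ k)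
            (tripleOverlap γ a t i₁ i₂ i₃ k) (pairOverlap γ a t i₁ i₃ 1)
            (pairOverlap γ a t i₁ i₂ h)) := by
  have haγ : 0 ≤ a * γ := by positivity
  have hkγ : 0 ≤ (k - 1) * γ := mul_nonneg (by linarith) (by linarith)
  have hhγ : 0 ≤ (h - 1) * γ := mul_nonneg (by linarith) (by linarith)
  have hkhγ : 0 ≤ (k - h) * γ := mul_nonneg (by linarith) (by linarith)
  refine sumTriples_shift γ ((a + k - 1) * γ) _ _ _ _ _ _ B _ (fun i₁ i₂ i₃ =>
      caseG (pairOverlap γ a t i₁ i₂ k) (pairOverlap γ a t i₁ i₃ k)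
          (tripleOverlap γ a t i₁ i₂ i₃ k) (pairOverlap γ a t i₁ i₂ 1)
          (pairOverlap γ a t i₁ i₃ h)) _ ?_ ?_ ?_
  · intro i₁ i₂ i₃ h0
    obtain ⟨n1, n2, n3, n4⟩ := caseG_ne_zero (triple_le_left hmono _ _ _) h0
    obtain ⟨⟨p1, q1⟩, r1, s1⟩ := pair_bounds ht n1
    obtain ⟨⟨p2, q2⟩, r2, s2⟩ := pair_bounds ht n2
    obtain ⟨⟨p3, q3⟩, r3, s3⟩ := pair_bounds ht n3
    obtain ⟨⟨p4, q4⟩, r4, s4⟩ := pair_bounds ht n4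
    refine ⟨⟨⟨?_, ?_⟩, ⟨?_, ?_⟩, ⟨?_, ?_⟩⟩, ⟨?_, ?_⟩, ⟨?_, ?_⟩, ⟨?_, ?_⟩⟩ <;> linarith
  · intro i₁ i₂ i₃
    simp only [pairOverlap, tripleOverlap]
    ring_nf
  · intro i₁ i₂ i₃
    simp only [tripleOverlap_comm γ a t i₁ i₂ i₃]

/-- The three lemmas on `caseI` correspond to the three ways to split the replicas `1 < h < w < k`
into two pairs. The row `i₂` gets the pair that contains replica `1`; the swapped summand gives it
to `i₃`. -/
theorem sumTriples_caseI_first (ht : ∀ s, t s ≠ 0 → ∀ i ∈ s, 0 ≤ i ∧ i ≤ (m + 1) * γ - 1)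
    (hγ : 1 ≤ γ) {a k B : ℤ} (ha : 0 ≤ a)
    (hB : (a + k + m) * γ - 1 ≤ B) {h w : ℤ} (h2 : 2 ≤ h) (hhw : h + 1 ≤ w) (hwk : w ≤ k - 1) :
    sumTriples γ ((k - 1) * γ) ((m + 1) * γ - 1) ((h - 1) * γ) ((m + 1) * γ - 1) ((k - 1) * γ)
        ((m + w) * γ - 1) (fun i₁ i₂ i₃ =>
      caseI (t {i₁, i₂}) (t {i₁ + (1 - h) * γ, i₂ + (1 - h) * γ}) (t {i₁ + (1 - w) * γ, i₃ +
          (1 - w) * γ}) (t {i₁ + (1 - k) * γ, i₃ + (1 - k) * γ})) =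
    sumPairs γ 0 B 0 B (fun i₁ i₂ i₃ =>
      caseI (pairOverlap γ a t i₁ i₂ 1) (pairOverlap γ a t i₁ i₂ h) (pairOverlap γ a t i₁ i₃ w)
          (pairOverlap γ a t i₁ i₃ k) +
        caseI (pairOverlap γ a t i₁ i₃ 1) (pairOverlap γ a t i₁ i₃ h) (pairOverlap γ a t i₁ i₂ w)
            (pairOverlap γ a t i₁ i₂ k)) := by
  have haγ : 0 ≤ a * γ := by positivity
  have hkγ : 0 ≤ (k - 1) * γ := mul_nonneg (by linarith) (by linarith)
  have hhγ : 0 ≤ (h - 1) * γ := mul_nonneg (by linarith) (by linarith)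
  have hwhγ : 0 ≤ (w - h) * γ := mul_nonneg (by linarith) (by linarith)
  have hkwγ : 0 ≤ (k - w) * γ := mul_nonneg (by linarith) (by linarith)
  refine sumTriples_shift γ (a * γ) _ _ _ _ _ _ B _ (fun i₁ i₂ i₃ =>
      caseI (pairOverlap γ a t i₁ i₂ 1) (pairOverlap γ a t i₁ i₂ h) (pairOverlap γ a t i₁ i₃ w)
          (pairOverlap γ a t i₁ i₃ k)) _ ?_ ?_ ?_
  · intro i₁ i₂ i₃ h0
    obtain ⟨n1, n2, n3, n4⟩ := caseI_ne_zero h0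
    obtain ⟨⟨p1, q1⟩, r1, s1⟩ := pair_bounds ht n1
    obtain ⟨⟨p2, q2⟩, r2, s2⟩ := pair_bounds ht n2
    obtain ⟨⟨p3, q3⟩, r3, s3⟩ := pair_bounds ht n3
    obtain ⟨⟨p4, q4⟩, r4, s4⟩ := pair_bounds ht n4
    refine ⟨⟨⟨?_, ?_⟩, ⟨?_, ?_⟩, ⟨?_, ?_⟩⟩, ⟨?_, ?_⟩, ⟨?_, ?_⟩, ⟨?_, ?_⟩⟩ <;> linarith
  · intro i₁ i₂ i₃
    simp only [pairOverlap]
    ring_nf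
  · intro i₁ i₂ i₃
    rfl

theorem sumTriples_caseI_second (ht : ∀ s, t s ≠ 0 → ∀ i ∈ s, 0 ≤ i ∧ i ≤ (m + 1) * γ - 1)
    (hγ : 1 ≤ γ) {a k B : ℤ} (ha : 0 ≤ a)
    (hB : (a + k + m) * γ - 1 ≤ B) {h w : ℤ} (h2 : 2 ≤ h) (hhw : h + 1 ≤ w) (hwk : w ≤ k - 1) :
    sumTriples γ ((k - 1) * γ) ((m + 1) * γ - 1) ((w - 1) * γ) ((m + 1) * γ - 1) ((k - 1) * γ)
        ((m + h) * γ - 1) (fun i₁ i₂ i₃ =>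
      caseI (t {i₁, i₂}) (t {i₁ + (1 - w) * γ, i₂ + (1 - w) * γ}) (t {i₁ + (1 - h) * γ, i₃ +
          (1 - h) * γ}) (t {i₁ + (1 - k) * γ, i₃ + (1 - k) * γ})) =
    sumPairs γ 0 B 0 B (fun i₁ i₂ i₃ =>
      caseI (pairOverlap γ a t i₁ i₂ 1) (pairOverlap γ a t i₁ i₂ w) (pairOverlap γ a t i₁ i₃ h)
          (pairOverlap γ a t i₁ i₃ k) +
        caseI (pairOverlap γ a t i₁ i₃ 1) (pairOverlap γ a t i₁ i₃ w) (pairOverlap γ a t i₁ i₂ h)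
            (pairOverlap γ a t i₁ i₂ k)) := by
  have haγ : 0 ≤ a * γ := by positivity
  have hkγ : 0 ≤ (k - 1) * γ := mul_nonneg (by linarith) (by linarith)
  have hhγ : 0 ≤ (h - 1) * γ := mul_nonneg (by linarith) (by linarith)
  have hwhγ : 0 ≤ (w - h) * γ := mul_nonneg (by linarith) (by linarith)
  have hkwγ : 0 ≤ (k - w) * γ := mul_nonneg (by linarith) (by linarith)
  refine sumTriples_shift γ (a * γ) _ _ _ _ _ _ B _ (fun i₁ i₂ i₃ =>
      caseI (pairOverlap γ a t i₁ i₂ 1) (pairOverlap γ a t i₁ i₂ w) (pairOverlap γ a t i₁ i₃ h)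
          (pairOverlap γ a t i₁ i₃ k)) _ ?_ ?_ ?_
  · intro i₁ i₂ i₃ h0
    obtain ⟨n1, n2, n3, n4⟩ := caseI_ne_zero h0
    obtain ⟨⟨p1, q1⟩, r1, s1⟩ := pair_bounds ht n1
    obtain ⟨⟨p2, q2⟩, r2, s2⟩ := pair_bounds ht n2
    obtain ⟨⟨p3, q3⟩, r3, s3⟩ := pair_bounds ht n3
    obtain ⟨⟨p4, q4⟩, r4, s4⟩ := pair_bounds ht n4
    refine ⟨⟨⟨?_, ?_⟩, ⟨?_, ?_⟩, ⟨?_, ?_⟩⟩, ⟨?_, ?_⟩, ⟨?_, ?_⟩, ⟨?_, ?_⟩⟩ <;> linarith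
  · intro i₁ i₂ i₃
    simp only [pairOverlap]
    ring_nf
  · intro i₁ i₂ i₃
    rfl

theorem sumTriples_caseI_third (ht : ∀ s, t s ≠ 0 → ∀ i ∈ s, 0 ≤ i ∧ i ≤ (m + 1) * γ - 1)
    (hγ : 1 ≤ γ) {a k B : ℤ} (ha : 0 ≤ a)
    (hB : (a + k + m) * γ - 1 ≤ B) {h w : ℤ} (h2 : 2 ≤ h) (hhw : h + 1 ≤ w) (hwk : w ≤ k - 1) :
    sumTriples γ ((k - 1) * γ) ((m + 1) * γ - 1) ((k - 1) * γ) ((m + 1) * γ - 1) ((w - 1) * γ)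
        ((m + h) * γ - 1) (fun i₁ i₂ i₃ =>
      caseI (t {i₁, i₂}) (t {i₁ + (1 - k) * γ, i₂ + (1 - k) * γ}) (t {i₁ + (1 - h) * γ, i₃ +
          (1 - h) * γ}) (t {i₁ + (1 - w) * γ, i₃ + (1 - w) * γ})) =
    sumPairs γ 0 B 0 B (fun i₁ i₂ i₃ =>
      caseI (pairOverlap γ a t i₁ i₂ 1) (pairOverlap γ a t i₁ i₂ k) (pairOverlap γ a t i₁ i₃ h)
          (pairOverlap γ a t i₁ i₃ w) +
        caseI (pairOverlap γ a t i₁ i₃ 1) (pairOverlap γ a t i₁ i₃ k) (pairOverlap γ a t i₁ i₂ h)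
            (pairOverlap γ a t i₁ i₂ w)) := by
  have haγ : 0 ≤ a * γ := by positivity
  have hkγ : 0 ≤ (k - 1) * γ := mul_nonneg (by linarith) (by linarith)
  have hhγ : 0 ≤ (h - 1) * γ := mul_nonneg (by linarith) (by linarith)
  have hwhγ : 0 ≤ (w - h) * γ := mul_nonneg (by linarith) (by linarith)
  have hkwγ : 0 ≤ (k - w) * γ := mul_nonneg (by linarith) (by linarith)
  refine sumTriples_shift γ (a * γ) _ _ _ _ _ _ B _ (fun i₁ i₂ i₃ =>
      caseI (pairOverlap γ a t i₁ i₂ 1) (pairOverlap γ a t i₁ i₂ k) (pairOverlap γ a t i₁ i₃ h)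
          (pairOverlap γ a t i₁ i₃ w)) _ ?_ ?_ ?_
  · intro i₁ i₂ i₃ h0
    obtain ⟨n1, n2, n3, n4⟩ := caseI_ne_zero h0
    obtain ⟨⟨p1, q1⟩, r1, s1⟩ := pair_bounds ht n1
    obtain ⟨⟨p2, q2⟩, r2, s2⟩ := pair_bounds ht n2
    obtain ⟨⟨p3, q3⟩, r3, s3⟩ := pair_bounds ht n3
    obtain ⟨⟨p4, q4⟩, r4, s4⟩ := pair_bounds ht n4
    refine ⟨⟨⟨?_, ?_⟩, ⟨?_, ?_⟩, ⟨?_, ?_⟩⟩, ⟨?_, ?_⟩, ⟨?_, ?_⟩, ⟨?_, ?_⟩⟩ <;> linarith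
  · intro i₁ i₂ i₃
    simp only [pairOverlap]
    ring_nf
  · intro i₁ i₂ i₃
    rfl

/-- Each 2-set has one node in each end replica, so the term is already symmetric in `i₂`, `i₃` and
no folding is needed. -/
theorem sumPairs_caseD (ht : ∀ s, t s ≠ 0 → ∀ i ∈ s, 0 ≤ i ∧ i ≤ (m + 1) * γ - 1)
    (hmono : Antitone t) (hγ : 1 ≤ γ) {a k B : ℤ} (ha : 0 ≤ a) (hk : 2 ≤ k)
    (hB : (a + k + m) * γ - 1 ≤ B) :
    sumPairs γ ((k - 1) * γ) ((m + 1) * γ - 1) ((k - 1) * γ) ((m + 1) * γ - 1) (fun i₁ i₂ i₃ =>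
      caseD (t {i₁, i₂}) (t {i₁, i₃}) (t {i₁, i₂, i₃}) (t {i₁ + (1 - k) * γ, i₂ + (1 - k) * γ})
          (t {i₁ + (1 - k) * γ, i₃ + (1 - k) * γ}) (t {i₁ + (1 - k) * γ, i₂ + (1 - k) * γ, i₃ +
          (1 - k) * γ})) =
    sumPairs γ 0 B 0 B (fun i₁ i₂ i₃ =>
      caseD (pairOverlap γ a t i₁ i₂ 1) (pairOverlap γ a t i₁ i₃ 1)
          (tripleOverlap γ a t i₁ i₂ i₃ 1) (pairOverlap γ a t i₁ i₂ k) (pairOverlap γ a t i₁ i₃ k)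
          (tripleOverlap γ a t i₁ i₂ i₃ k)) := by
  have haγ : 0 ≤ a * γ := by positivity
  have hkγ : 0 ≤ (k - 1) * γ := mul_nonneg (by linarith) (by linarith)
  refine sumPairs_shift γ (a * γ) _ _ _ _ B _ (fun i₁ i₂ i₃ =>
      caseD (pairOverlap γ a t i₁ i₂ 1) (pairOverlap γ a t i₁ i₃ 1)
          (tripleOverlap γ a t i₁ i₂ i₃ 1) (pairOverlap γ a t i₁ i₂ k) (pairOverlap γ a t i₁ i₃ k)
          (tripleOverlap γ a t i₁ i₂ i₃ k)) ?_ ?_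
  · intro i₁ i₂ i₃ h0
    obtain ⟨n1, n2, n3, n4⟩ := caseD_ne_zero (triple_le_left hmono _ _ _)
        (triple_le_left hmono _ _ _) h0
    obtain ⟨⟨p1, q1⟩, r1, s1⟩ := pair_bounds ht n1
    obtain ⟨⟨p2, q2⟩, r2, s2⟩ := pair_bounds ht n2
    obtain ⟨⟨p3, q3⟩, r3, s3⟩ := pair_bounds ht n3
    obtain ⟨⟨p4, q4⟩, r4, s4⟩ := pair_bounds ht n4
    refine ⟨⟨⟨?_, ?_⟩, ⟨?_, ?_⟩, ⟨?_, ?_⟩⟩, ⟨?_, ?_⟩, ⟨?_, ?_⟩, ⟨?_, ?_⟩⟩ <;> linarith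
  · intro i₁ i₂ i₃
    simp only [pairOverlap, tripleOverlap]
    ring_nf

theorem formula4_eq (ht : ∀ s, t s ≠ 0 → ∀ i ∈ s, 0 ≤ i ∧ i ≤ (m + 1) * γ - 1)
    (hmono : Antitone t) (hγ : 1 ≤ γ) {a k B : ℤ} (ha : 0 ≤ a) (hk : 2 ≤ k)
    (hB : (a + k + m) * γ - 1 ≤ B) :
    formula4 γ m k t = sumPairs γ 0 B 0 B (fun i₁ i₂ i₃ =>
      windowCount (pairOverlap γ a t i₁ i₂) (pairOverlap γ a t i₁ i₃)
        (tripleOverlap γ a t i₁ i₂ i₃) k) := by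
  unfold formula4 windowCount
  rw [sumTriples_caseB_first ht hmono hγ ha hk hB, sumTriples_caseB_last ht hmono hγ ha hk hB,
    sumTriples_caseC ht hγ ha hk hB, sumPairs_caseD ht hmono hγ ha hk hB,
    Finset.sum_congr rfl fun h hh => sumTriples_caseE_first ht hγ ha hB
      (Finset.mem_Icc.1 hh).1 (Finset.mem_Icc.1 hh).2,
    Finset.sum_congr rfl fun h hh => sumTriples_caseE_middle ht hγ ha hB
      (Finset.mem_Icc.1 hh).1 (Finset.mem_Icc.1 hh).2,
    Finset.sum_congr rfl fun h hh => sumTriples_caseE_last ht hγ ha hB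
      (Finset.mem_Icc.1 hh).1 (Finset.mem_Icc.1 hh).2,
    Finset.sum_congr rfl fun h hh => sumTriples_caseG_first ht hmono hγ ha hB
      (Finset.mem_Icc.1 hh).1 (Finset.mem_Icc.1 hh).2,
    Finset.sum_congr rfl fun h hh => sumTriples_caseG_middle ht hmono hγ ha hB
      (Finset.mem_Icc.1 hh).1 (Finset.mem_Icc.1 hh).2,
    Finset.sum_congr rfl fun h hh => sumTriples_caseG_last ht hmono hγ ha hB
      (Finset.mem_Icc.1 hh).1 (Finset.mem_Icc.1 hh).2,
    Finset.sum_congr rfl fun h hh => Finset.sum_congr rfl fun w hw =>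
      sumTriples_caseI_first ht hγ ha hB (Finset.mem_Icc.1 hh).1 (Finset.mem_Icc.1 hw).1
        (Finset.mem_Icc.1 hw).2,
    Finset.sum_congr rfl fun h hh => Finset.sum_congr rfl fun w hw =>
      sumTriples_caseI_second ht hγ ha hB (Finset.mem_Icc.1 hh).1 (Finset.mem_Icc.1 hw).1
        (Finset.mem_Icc.1 hw).2,
    Finset.sum_congr rfl fun h hh => Finset.sum_congr rfl fun w hw =>
      sumTriples_caseI_third ht hγ ha hB (Finset.mem_Icc.1 hh).1 (Finset.mem_Icc.1 hw).1
        (Finset.mem_Icc.1 hw).2]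
  simp only [sumPairs_add, sumPairs_sum]

/-- The general formula covers the small cases: for `k = 2` all sums over `h` are empty, and for `k
= 3` only `h = 2` survives while the double sums are empty. -/
theorem formula2_eq_formula4 (γ m : ℤ) (t : Finset ℤ → ℕ) : formula2 γ m t = formula4 γ m 2 t := by
  unfold formula2 formula4
  norm_num [← sub_eq_add_neg]

theorem formula3_eq_formula4 (γ m : ℤ) (t : Finset ℤ → ℕ) : formula3 γ m t = formula4 γ m 3 t := by
  unfold formula3 formula4
  have h : m - 3 + 2 = m - 1 := by ring
  norm_num [← sub_eq_add_neg, h]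

end


/-! ### Disjoint pairs of 2-sets -/

/-- For a given `P`, the set `Q` is any 2-subset of `Y \ P`, so its number of choices depends only
on `|P ∩ Y|`. The three terms of `caseA` are the classes `|P ∩ Y| = 2, 1, 0`. -/
theorem card_disjoint_pairs {α : Type*} [DecidableEq α] (X Y : Finset α) :
    ((X.powersetCard 2 ×ˢ Y.powersetCard 2).filter fun p => Disjoint p.1 p.2).card =
      caseA X.card Y.card (X ∩ Y).card := by
  have h0 : ((X.powersetCard 2 ×ˢ Y.powersetCard 2).filter fun p => Disjoint p.1 p.2).card =
      ∑ P ∈ X.powersetCard 2, (Y.card - (P ∩ Y).card).choose 2 := by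
    rw [Finset.card_filter, Finset.sum_product]
    refine Finset.sum_congr rfl fun P _ => ?_
    rw [← Finset.card_filter, ← Finset.card_sdiff, ← Finset.card_powersetCard]
    congr 1
    ext Q
    simp only [Finset.mem_filter, Finset.mem_powersetCard, Finset.subset_sdiff]
    rw [disjoint_comm]
    tauto
  have hmaps : ∀ P ∈ X.powersetCard 2, (P ∩ Y).card ∈ Finset.range 3 := by
    intro P hP
    have := Finset.card_le_card (Finset.inter_subset_left : P ∩ Y ⊆ P)
    rw [(Finset.mem_powersetCard.1 hP).2] at this
    simp; omega
  have hz : (X ∩ Y).card ≤ X.card := Finset.card_le_card Finset.inter_subset_left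
  have c2 : ((X.powersetCard 2).filter fun P => (P ∩ Y).card = 2).card =
      (X ∩ Y).card.choose 2 := by
    rw [← Finset.card_powersetCard]
    congr 1
    ext P
    simp only [Finset.mem_filter, Finset.mem_powersetCard, Finset.subset_inter_iff]
    constructor
    · rintro ⟨⟨h1, h2⟩, h3⟩
      exact ⟨⟨h1, Finset.inter_eq_left.1
        (Finset.eq_of_subset_of_card_le Finset.inter_subset_left (by omega))⟩, h2⟩
    · rintro ⟨⟨h1, h2⟩, h3⟩
      exact ⟨⟨h1, h3⟩, by rw [Finset.inter_eq_left.2 h2, h3]⟩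
  have c0 : ((X.powersetCard 2).filter fun P => (P ∩ Y).card = 0).card =
      (X.card - (X ∩ Y).card).choose 2 := by
    rw [Finset.inter_comm, ← Finset.card_sdiff, ← Finset.card_powersetCard]
    congr 1
    ext P
    simp only [Finset.mem_filter, Finset.mem_powersetCard, Finset.subset_sdiff,
      Finset.card_eq_zero, ← Finset.disjoint_iff_inter_eq_empty]
    tauto
  -- This class is found by subtraction: with `x = z + d`, removing `z.choose 2` and `d.choose 2`
  -- from `x.choose 2` leaves `z * d`.
  have c1 : ((X.powersetCard 2).filter fun P => (P ∩ Y).card = 1).card =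
      (X ∩ Y).card * (X.card - (X ∩ Y).card) := by
    have h := Finset.card_eq_sum_card_fiberwise hmaps
    simp only [Finset.sum_range_succ, Finset.sum_range_zero, Finset.card_powersetCard, c0, c2] at h
    obtain ⟨d, hd⟩ := Nat.exists_eq_add_of_le hz
    rw [hd, Nat.add_sub_cancel_left] at h ⊢
    have h' := congrArg (fun n : ℕ => (n : ℚ)) h
    push_cast [Nat.cast_choose_two] at h'
    have : ((((X.powersetCard 2).filter fun P => (P ∩ Y).card = 1).card : ℕ) : ℚ) =
        (((X ∩ Y).card * d : ℕ) : ℚ) := by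
      push_cast
      linear_combination -h'
    exact_mod_cast this
  rw [h0, ← Finset.sum_fiberwise_of_maps_to hmaps]
  have h1 : ∀ j ∈ Finset.range 3, ∑ P ∈ (X.powersetCard 2).filter (fun P => (P ∩ Y).card = j),
      (Y.card - (P ∩ Y).card).choose 2 =
      ((X.powersetCard 2).filter fun P => (P ∩ Y).card = j).card * (Y.card - j).choose 2 := by
    intro j _
    rw [Finset.sum_congr rfl (g := fun _ => (Y.card - j).choose 2), Finset.sum_const, smul_eq_mul]
    intro P hP
    rw [(Finset.mem_filter.1 hP).2]
  rw [Finset.sum_congr rfl h1]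
  simp only [Finset.sum_range_succ, Finset.sum_range_zero, c0, c1, c2, caseA, Nat.sub_zero]
  ring

/-! ### Copies of `P7` and their parametrization -/

section

variable {R C : Type*}

/-- The columns in `W` that are adjacent to the row `r`. -/
def neighbors (A : Matrix R C ℕ) (W : Finset C) (r : R) : Finset C := W.filter fun c => A r c = 1

/-- The condition on two sets `P` and `Q` of variable nodes and check nodes `c₁, c₂, c₃` that makes
the edges from `c₁` to `P ∪ Q`, from `c₂` to `P` and from `c₃` to `Q` a copy of `P7`. -/
structure IsP7Data (c₁ c₂ c₃ : R) (P Q : Finset C) : Prop where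
  ne₁₂ : c₁ ≠ c₂
  ne₁₃ : c₁ ≠ c₃
  ne₂₃ : c₂ ≠ c₃
  cardP : P.card = 2
  cardQ : Q.card = 2
  disj : Disjoint P Q

theorem IsP7Data.swap {c₁ c₂ c₃ : R} {P Q : Finset C} (h : IsP7Data c₁ c₂ c₃ P Q) :
    IsP7Data c₁ c₃ c₂ Q P :=
  ⟨h.ne₁₃, h.ne₁₂, h.ne₂₃.symm, h.cardQ, h.cardP, h.disj.symm⟩

variable [LinearOrder R] [DecidableEq C]

/-- The copy of `P7` with check nodes `c₁, c₂, c₃`, in which `P` and `Q` are the sets of variable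
nodes joined to `c₂` and to `c₃`. -/
def copyP7 (c₁ c₂ c₃ : R) (P Q : Finset C) : Finset (R × C) :=
  {c₁} ×ˢ (P ∪ Q) ∪ ({c₂} ×ˢ P ∪ {c₃} ×ˢ Q)

theorem mem_copyP7 {c₁ c₂ c₃ : R} {P Q : Finset C} {e : R × C} : e ∈ copyP7 c₁ c₂ c₃ P Q ↔
    (e.1 = c₁ ∧ (e.2 ∈ P ∨ e.2 ∈ Q)) ∨ (e.1 = c₂ ∧ e.2 ∈ P) ∨ (e.1 = c₃ ∧ e.2 ∈ Q) := by
  simp only [copyP7, Finset.mem_union, Finset.mem_product, Finset.mem_singleton]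

/-- This is the symmetry of `P7` that would count every copy twice; requiring `c₂ < c₃` selects one
of the two descriptions. -/
theorem copyP7_swap (c₁ c₂ c₃ : R) (P Q : Finset C) :
    copyP7 c₁ c₂ c₃ P Q = copyP7 c₁ c₃ c₂ Q P := by
  ext e
  simp only [mem_copyP7]
  tauto

/-- The columns joined to a row in a set of edges. -/
def edgeFiber (S : Finset (R × C)) (r : R) : Finset C := (S.filter fun e => e.1 = r).image Prod.snd

theorem edgeFiber_copyP7 {c₁ c₂ c₃ : R} {P Q : Finset C} (h : IsP7Data c₁ c₂ c₃ P Q) (r : R) :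
    edgeFiber (copyP7 c₁ c₂ c₃ P Q) r =
      if r = c₁ then P ∪ Q else if r = c₂ then P else if r = c₃ then Q else ∅ := by
  ext c
  have : c ∈ edgeFiber (copyP7 c₁ c₂ c₃ P Q) r ↔ (r, c) ∈ copyP7 c₁ c₂ c₃ P Q := by
    simp [edgeFiber]
  rw [this, mem_copyP7]
  have := h.ne₁₂
  have := h.ne₁₃
  have := h.ne₂₃
  split_ifs <;> simp_all

theorem card_edgeFiber_copyP7 {c₁ c₂ c₃ : R} {P Q : Finset C} (h : IsP7Data c₁ c₂ c₃ P Q) (r : R) :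
    (edgeFiber (copyP7 c₁ c₂ c₃ P Q) r).card =
      if r = c₁ then 4 else if r = c₂ then 2 else if r = c₃ then 2 else 0 := by
  rw [edgeFiber_copyP7 h]
  split_ifs
  · rw [Finset.card_union_of_disjoint h.disj, h.cardP, h.cardQ]
  · exact h.cardP
  · exact h.cardQ
  · rfl

/-- The edge set determines its data: `c₁` is the only row of degree 4, `c₂ < c₃` are the rows of
degree 2 in increasing order, and `P`, `Q` are their fibres. -/
theorem copyP7_injective {c₁ c₂ c₃ d₁ d₂ d₃ : R} {P Q P' Q' : Finset C}
    (h : IsP7Data c₁ c₂ c₃ P Q) (h' : IsP7Data d₁ d₂ d₃ P' Q') (hc : c₂ < c₃) (hd : d₂ < d₃)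
    (he : copyP7 c₁ c₂ c₃ P Q = copyP7 d₁ d₂ d₃ P' Q') :
    c₁ = d₁ ∧ c₂ = d₂ ∧ c₃ = d₃ ∧ P = P' ∧ Q = Q' := by
  have hcard := fun r => (card_edgeFiber_copyP7 h r).symm.trans
    ((congrArg (fun S => (edgeFiber S r).card) he).trans (card_edgeFiber_copyP7 h' r))
  have hfib := fun r => (edgeFiber_copyP7 h r).symm.trans
    ((congrArg (edgeFiber · r) he).trans (edgeFiber_copyP7 h' r))
  have e1 : c₁ = d₁ := by
    have := hcard c₁
    rw [if_pos rfl] at this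
    split_ifs at this with h1
    · exact h1
    all_goals omega
  subst e1
  have e2 : c₂ = d₂ ∨ c₂ = d₃ := by
    have := hcard c₂
    rw [if_neg h.ne₁₂.symm, if_neg h.ne₁₂.symm, if_pos rfl] at this
    split_ifs at this with h1 h2
    exacts [Or.inl h1, Or.inr h2]
  have e3 : c₃ = d₂ ∨ c₃ = d₃ := by
    have := hcard c₃
    rw [if_neg h.ne₁₃.symm, if_neg h.ne₁₃.symm, if_neg h.ne₂₃.symm, if_pos rfl] at this
    split_ifs at this with h1 h2
    exacts [Or.inl h1, Or.inr h2]
  have e2' : c₂ = d₂ := by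
    rcases e2 with e2 | rfl
    · exact e2
    · rcases e3 with rfl | rfl
      · exact absurd hc hd.not_gt
      · exact absurd hc (lt_irrefl _)
  subst e2'
  have e3' : c₃ = d₃ := e3.resolve_left h.ne₂₃.symm
  subst e3'
  refine ⟨rfl, rfl, rfl, ?_, ?_⟩
  · simpa [h.ne₁₂.symm] using hfib c₂
  · simpa [h.ne₁₃.symm, h.ne₂₃.symm] using hfib c₃

theorem isPatternInstance_copyP7 {A : Matrix R C ℕ} {c₁ c₂ c₃ : R} {P Q : Finset C}
    (h : IsP7Data c₁ c₂ c₃ P Q) (hA : ∀ e ∈ copyP7 c₁ c₂ c₃ P Q, A e.1 e.2 = 1) :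
    IsPatternInstance P7 A (copyP7 c₁ c₂ c₃ P Q) := by
  refine ⟨?_, hA⟩
  obtain ⟨p, p', hp, rfl⟩ := Finset.card_eq_two.1 h.cardP
  obtain ⟨q, q', hq, rfl⟩ := Finset.card_eq_two.1 h.cardQ
  have hd := h.disj
  simp only [Finset.disjoint_insert_left, Finset.disjoint_singleton_left, Finset.mem_insert,
    Finset.mem_singleton, not_or] at hd
  obtain ⟨⟨h1, h2⟩, h3, h4⟩ := hd
  refine ⟨⟨![c₁, c₂, c₃], ?_⟩, ⟨![p, p', q, q'], ?_⟩, ?_⟩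
  · have := h.ne₁₂
    have := h.ne₁₃
    have := h.ne₂₃
    intro i j hij
    fin_cases i <;> fin_cases j <;> simp_all
  · intro i j hij
    fin_cases i <;> fin_cases j <;> simp_all
  · rintro ⟨r, c⟩
    rw [mem_copyP7]
    simp [P7, Fin.exists_fin_succ, Prod.ext_iff]
    change _ ↔ (r = c₁ ∧ c = p ∨ r = c₁ ∧ c = p' ∨ r = c₁ ∧ c = q ∨ r = c₁ ∧ c = q') ∨
      (r = c₂ ∧ c = p ∨ r = c₂ ∧ c = p') ∨ r = c₃ ∧ c = q ∨ r = c₃ ∧ c = q'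
    simp only [and_or_left, or_assoc]

theorem exists_copyP7_of_isPatternInstance {A : Matrix R C ℕ} {S : Finset (R × C)}
    (h : IsPatternInstance P7 A S) :
    ∃ c₁ c₂ c₃ P Q, IsP7Data c₁ c₂ c₃ P Q ∧ c₂ < c₃ ∧ copyP7 c₁ c₂ c₃ P Q = S := by
  obtain ⟨⟨f, g, hS⟩, -⟩ := h
  have hf : ∀ i j, i ≠ j → f i ≠ f j := fun i j h h' => h (f.injective h')
  have hg : ∀ i j, i ≠ j → g i ≠ g j := fun i j h h' => h (g.injective h')
  have hdata : IsP7Data (f 0) (f 1) (f 2) {g 0, g 1} {g 2, g 3} := by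
    refine ⟨hf _ _ (by decide), hf _ _ (by decide), hf _ _ (by decide),
      Finset.card_pair (hg _ _ (by decide)), Finset.card_pair (hg _ _ (by decide)), ?_⟩
    simp
  have hcopy : copyP7 (f 0) (f 1) (f 2) {g 0, g 1} {g 2, g 3} = S := by
    ext ⟨r, c⟩
    rw [mem_copyP7, hS]
    simp [P7, Fin.exists_fin_succ, Prod.ext_iff]
    tauto
  rcases lt_or_gt_of_ne hdata.ne₂₃ with hlt | hlt
  · exact ⟨_, _, _, _, _, hdata, hlt, hcopy⟩
  · exact ⟨_, _, _, _, _, hdata.swap, hlt, by rw [← copyP7_swap, hcopy]⟩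

/-- The number of instances of `P7` that have their variable nodes in a given set. -/
theorem ncard_isPatternInstance_P7 [Fintype R] (A : Matrix R C ℕ) (W : Finset C) :
    Set.ncard {S : Finset (R × C) | IsPatternInstance P7 A S ∧ ∀ e ∈ S, e.2 ∈ W} =
      ∑ c₁ : R, ∑ c₂ : R, ∑ c₃ : R, if c₁ ≠ c₂ ∧ c₁ ≠ c₃ ∧ c₂ < c₃ then
        caseA (neighbors A W c₁ ∩ neighbors A W c₂).card (neighbors A W c₁ ∩ neighbors A W c₃).card
          ((neighbors A W c₁ ∩ neighbors A W c₂) ∩ (neighbors A W c₁ ∩ neighbors A W c₃)).card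
      else 0 := by
  classical
  let N := neighbors A W
  -- `D` is the set of all admissible data with `c₂ < c₃`; `Φ` maps it bijectively onto the
  -- instances, so the count is a sum of fibre sizes over the check nodes.
  let D : Finset (Σ _ : R × R × R, Finset C × Finset C) :=
    (Finset.univ.filter fun c : R × R × R => c.1 ≠ c.2.1 ∧ c.1 ≠ c.2.2 ∧ c.2.1 < c.2.2).sigma
      fun c => ((N c.1 ∩ N c.2.1).powersetCard 2 ×ˢ (N c.1 ∩ N c.2.2).powersetCard 2).filter
        fun p => Disjoint p.1 p.2
  let Φ : (Σ _ : R × R × R, Finset C × Finset C) → Finset (R × C) :=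
    fun d => copyP7 d.1.1 d.1.2.1 d.1.2.2 d.2.1 d.2.2
  have hD : ∀ c₁ c₂ c₃ P Q, (⟨(c₁, c₂, c₃), (P, Q)⟩ : Σ _ : R × R × R, Finset C × Finset C) ∈ D ↔
      IsP7Data c₁ c₂ c₃ P Q ∧ c₂ < c₃ ∧ P ⊆ N c₁ ∩ N c₂ ∧ Q ⊆ N c₁ ∩ N c₃ := by
    intro c₁ c₂ c₃ P Q
    simp only [D, Finset.mem_sigma, Finset.mem_filter, Finset.mem_univ, true_and,
      Finset.mem_product, Finset.mem_powersetCard]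
    constructor
    · rintro ⟨⟨h1, h2, h3⟩, ⟨⟨h4, h5⟩, h6, h7⟩, h8⟩
      exact ⟨⟨h1, h2, h3.ne, h5, h7, h8⟩, h3, h4, h6⟩
    · rintro ⟨⟨h1, h2, -, h5, h7, h8⟩, h3, h4, h6⟩
      exact ⟨⟨h1, h2, h3⟩, ⟨⟨h4, h5⟩, h6, h7⟩, h8⟩
  have himage : {S : Finset (R × C) | IsPatternInstance P7 A S ∧ ∀ e ∈ S, e.2 ∈ W} =
      ((D.image Φ : Finset (Finset (R × C))) : Set (Finset (R × C))) := by
    ext S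
    simp only [Set.mem_ofPred_eq, Finset.coe_image, Set.mem_image, Finset.mem_coe]
    constructor
    · rintro ⟨hS, hW⟩
      obtain ⟨c₁, c₂, c₃, P, Q, hd, hlt, rfl⟩ := exists_copyP7_of_isPatternInstance hS
      refine ⟨⟨(c₁, c₂, c₃), (P, Q)⟩, (hD _ _ _ _ _).2 ⟨hd, hlt, ?_, ?_⟩, rfl⟩
      · intro c hc
        have m1 : (c₁, c) ∈ copyP7 c₁ c₂ c₃ P Q := mem_copyP7.2 (by simp [hc])
        have m2 : (c₂, c) ∈ copyP7 c₁ c₂ c₃ P Q := mem_copyP7.2 (by simp [hc])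
        simp only [N, neighbors, Finset.mem_inter, Finset.mem_filter]
        exact ⟨⟨hW _ m1, hS.2 _ m1⟩, hW _ m2, hS.2 _ m2⟩
      · intro c hc
        have m1 : (c₁, c) ∈ copyP7 c₁ c₂ c₃ P Q := mem_copyP7.2 (by simp [hc])
        have m2 : (c₃, c) ∈ copyP7 c₁ c₂ c₃ P Q := mem_copyP7.2 (by simp [hc])
        simp only [N, neighbors, Finset.mem_inter, Finset.mem_filter]
        exact ⟨⟨hW _ m1, hS.2 _ m1⟩, hW _ m2, hS.2 _ m2⟩
    · rintro ⟨⟨⟨c₁, c₂, c₃⟩, P, Q⟩, hd, rfl⟩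
      obtain ⟨hd, -, hP, hQ⟩ := (hD _ _ _ _ _).1 hd
      have key : ∀ e ∈ copyP7 c₁ c₂ c₃ P Q, e.2 ∈ N e.1 := by
        rintro ⟨r, c⟩ he
        rcases mem_copyP7.1 he with ⟨rfl, hc | hc⟩ | ⟨rfl, hc⟩ | ⟨rfl, hc⟩
        · exact (Finset.mem_inter.1 (hP hc)).1
        · exact (Finset.mem_inter.1 (hQ hc)).1
        · exact (Finset.mem_inter.1 (hP hc)).2
        · exact (Finset.mem_inter.1 (hQ hc)).2
      exact ⟨isPatternInstance_copyP7 hd fun e he => (Finset.mem_filter.1 (key e he)).2,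
        fun e he => (Finset.mem_filter.1 (key e he)).1⟩
  have hinj : Set.InjOn Φ D := by
    rintro ⟨⟨c₁, c₂, c₃⟩, P, Q⟩ h ⟨⟨d₁, d₂, d₃⟩, P', Q'⟩ h' he
    obtain ⟨h, hlt, -⟩ := (hD _ _ _ _ _).1 h
    obtain ⟨h', hlt', -⟩ := (hD _ _ _ _ _).1 h'
    obtain ⟨rfl, rfl, rfl, rfl, rfl⟩ := copyP7_injective h h' hlt hlt' he
    rfl
  rw [himage, Set.ncard_coe_finset, Finset.card_image_of_injOn hinj, Finset.card_sigma,
    Finset.sum_filter, Fintype.sum_prod_type]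
  refine Finset.sum_congr rfl fun c₁ _ => ?_
  rw [Fintype.sum_prod_type]
  refine Finset.sum_congr rfl fun c₂ _ => Finset.sum_congr rfl fun c₃ _ => ?_
  simp only [card_disjoint_pairs, N]

end


/-! ### Overlap parameters as column counts in the coupled matrix -/

section

variable {γ κ m : ℕ}

open Classical in
/-- The columns of the stacked matrix that have a `1` in the row `i`. -/
noncomputable def rowSupport (H : Fin (m + 1) → Matrix (Fin γ) (Fin κ) ℕ) (i : ℤ) :
    Finset (Fin κ) :=
  Finset.univ.filter fun j => ∃ a : Fin ((m + 1) * γ), (a : ℤ) = i ∧ stackedMatrix H a j = 1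

theorem overlapParam_eq_card (H : Fin (m + 1) → Matrix (Fin γ) (Fin κ) ℕ) (s : Finset ℤ) :
    overlapParam H s = (Finset.univ.filter fun j => ∀ i ∈ s, j ∈ rowSupport H i).card := by
  classical
  rw [overlapParam, ← Set.ncard_coe_finset]
  congr 1
  ext j
  simp [rowSupport]

theorem bounds_of_mem_rowSupport {H : Fin (m + 1) → Matrix (Fin γ) (Fin κ) ℕ} {i : ℤ} {j : Fin κ}
    (h : j ∈ rowSupport H i) : 0 ≤ i ∧ i ≤ ((m : ℤ) + 1) * γ - 1 := by
  obtain ⟨a, rfl, -⟩ := (Finset.mem_filter.1 h).2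
  have := a.2
  zify at this
  exact ⟨by positivity, by linarith⟩

theorem overlapParam_bounds (H : Fin (m + 1) → Matrix (Fin γ) (Fin κ) ℕ) (s : Finset ℤ)
    (hs : overlapParam H s ≠ 0) : ∀ i ∈ s, 0 ≤ i ∧ i ≤ ((m : ℤ) + 1) * γ - 1 := by
  rw [overlapParam_eq_card] at hs
  obtain ⟨j, hj⟩ := Finset.card_ne_zero.1 hs
  exact fun i hi => bounds_of_mem_rowSupport ((Finset.mem_filter.1 hj).2 i hi)

theorem overlapParam_antitone (H : Fin (m + 1) → Matrix (Fin γ) (Fin κ) ℕ) :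
    Antitone (overlapParam H) := by
  intro s s' hs
  simp only [overlapParam_eq_card]
  exact Finset.card_le_card fun j hj => Finset.mem_filter.2
    ⟨Finset.mem_univ _, fun i hi => (Finset.mem_filter.1 hj).2 i (hs hi)⟩

/-- Rows congruent modulo `γ` are the same row of different components. The components sum to the
all-ones matrix, so two of them cannot both have a `1` at one position. -/
theorem mem_rowSupport_unique {H : Fin (m + 1) → Matrix (Fin γ) (Fin κ) ℕ}
    (hH : ∑ y, H y = Matrix.of fun _ _ => 1) {i i' : ℤ} (hi : i % γ = i' % γ) {j : Fin κ}
    (hj : j ∈ rowSupport H i) (hj' : j ∈ rowSupport H i') : i = i' := by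
  obtain ⟨a, rfl, ha⟩ := (Finset.mem_filter.1 hj).2
  obtain ⟨a', rfl, ha'⟩ := (Finset.mem_filter.1 hj').2
  have hmod : a.modNat = a'.modNat := by
    ext
    simp only [Fin.coe_modNat]
    exact_mod_cast hi
  simp only [stackedMatrix, Matrix.of_apply] at ha ha'
  have hdiv : a.divNat = a'.divNat := by
    by_contra hne
    have hsum := congrFun (congrFun hH a.modNat) j
    rw [Matrix.sum_apply, Matrix.of_apply] at hsum
    have hle := Finset.sum_le_sum_of_subset (f := fun y => H y a.modNat j)
      (Finset.subset_univ {a.divNat, a'.divNat})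
    rw [Finset.sum_pair hne, ha, hmod, ha', ← hmod, hsum] at hle
    omega
  have h1 : (a : ℕ) / γ = a' / γ := congrArg Fin.val hdiv
  have h2 : (a : ℕ) % γ = a' % γ := congrArg Fin.val hmod
  rw [← Nat.div_add_mod (a : ℕ) γ, h1, h2, Nat.div_add_mod]

theorem overlapParam_eq_zero {H : Fin (m + 1) → Matrix (Fin γ) (Fin κ) ℕ}
    (hH : ∑ y, H y = Matrix.of fun _ _ => 1) {i i' : ℤ} (hi : i % γ = i' % γ) (hne : i ≠ i')
    {s : Finset ℤ} (h1 : i ∈ s) (h2 : i' ∈ s) : overlapParam H s = 0 := by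
  rw [overlapParam_eq_card, Finset.card_eq_zero, Finset.filter_eq_empty_iff]
  exact fun j _ h => hne (mem_rowSupport_unique hH hi (h i h1) (h i' h2))

/-- A column of block column `C` sees the stacked matrix moved down by `C * γ` rows. The zero blocks
need no separate case, because `rowSupport` is empty at indices outside the stacked matrix. -/
theorem scMatrix_eq_one_iff (L : ℕ) (H : Fin (m + 1) → Matrix (Fin γ) (Fin κ) ℕ)
    (i : Fin ((L + m) * γ)) (j : Fin (L * κ)) :
    scMatrix L H i j = 1 ↔ j.modNat ∈ rowSupport H ((i : ℤ) - (j.divNat : ℕ) * γ) := by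
  have hi : (i : ℕ) = γ * (i.divNat : ℕ) + (i.modNat : ℕ) := by
    simp only [Fin.coe_divNat, Fin.coe_modNat, Nat.div_add_mod]
  have h1 : scMatrix L H i j = 1 ↔ ∃ y : Fin (m + 1), (i.divNat : ℕ) = (j.divNat : ℕ) + y ∧
      H y i.modNat j.modNat = 1 := by
    simp only [scMatrix, Matrix.of_apply]
    by_cases hy : ∃ y : Fin (m + 1), (i.divNat : ℕ) = (j.divNat : ℕ) + y
    · obtain ⟨y, hy⟩ := hy
      have huniq : ∀ y' : Fin (m + 1), (i.divNat : ℕ) = (j.divNat : ℕ) + y' → y' = y := by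
        intro y' hy'
        ext
        omega
      rw [Finset.sum_eq_single y]
      · rw [if_pos hy]
        exact ⟨fun h => ⟨y, hy, h⟩, fun ⟨y', hy', h⟩ => huniq y' hy' ▸ h⟩
      · intro y' _ hne
        rw [if_neg fun h => hne (huniq y' h)]
      · simp
    · rw [Finset.sum_eq_zero]
      · simp only [zero_ne_one, false_iff]
        exact fun ⟨y, h, _⟩ => hy ⟨y, h⟩
      · exact fun y _ => if_neg fun h => hy ⟨y, h⟩
  rw [h1, rowSupport, Finset.mem_filter]
  simp only [Finset.mem_univ, true_and, stackedMatrix, Matrix.of_apply]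
  have hr := i.modNat.2
  constructor
  · rintro ⟨y, hy, h⟩
    refine ⟨finProdFinEquiv (y, i.modNat), ?_, ?_⟩
    · rw [finProdFinEquiv_apply_val]
      have : (i : ℤ) = γ * ((i.divNat : ℕ) : ℤ) + ((i.modNat : ℕ) : ℤ) := by exact_mod_cast hi
      rw [this, hy]
      push_cast
      ring
    · have h3 := finProdFinEquiv.symm_apply_apply (y, i.modNat)
      rw [finProdFinEquiv_symm_apply, Prod.mk.injEq] at h3
      rw [h3.1, h3.2, h]
  · rintro ⟨a, ha, h⟩
    have hia : (i : ℕ) = a + j.divNat * γ := by zify; linarith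
    have hγ : 0 < γ := by omega
    refine ⟨a.divNat, ?_, ?_⟩
    · simp only [Fin.coe_divNat] at hia ⊢
      rw [hia, Nat.add_mul_div_right _ _ hγ, add_comm]
    · have : i.modNat = a.modNat := by
        ext
        simp only [Fin.coe_modNat]
        rw [hia, Nat.add_mul_mod_self_right]
      rw [this, h]

/-- The columns in the replicas `a + p, …, a + q`. -/
def window (L κ : ℕ) (a p q : ℤ) : Finset (Fin (L * κ)) :=
  Finset.univ.filter fun j => p ≤ (j.divNat : ℕ) - a + 1 ∧ (j.divNat : ℕ) - a + 1 ≤ q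

/-- Sort the columns by replica: within one replica, membership in the given rows is membership in
the rows shifted back. The bounds `hp` and `hq` ensure that every replica of the window exists. -/
theorem card_window_filter {L : ℕ} (H : Fin (m + 1) → Matrix (Fin γ) (Fin κ) ℕ) {a p q : ℤ}
    (hp : 0 ≤ a + p - 1) (hq : a + q ≤ L) (s : Finset ℤ) :
    ((window L κ a p q).filter fun j => ∀ i ∈ s,
      j.modNat ∈ rowSupport H (i - (j.divNat : ℕ) * γ)).card =
    ∑ h ∈ Finset.Icc p q, overlapParam H (s.image fun i => i - (a + h - 1) * γ) := by
  rw [Finset.card_eq_sum_card_fiberwise (f := fun j => ((j.divNat : ℕ) : ℤ) - a + 1)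
    (t := Finset.Icc p q)]
  · refine Finset.sum_congr rfl fun h hh => ?_
    rw [Finset.mem_Icc] at hh
    rw [overlapParam_eq_card]
    refine Finset.card_bij (fun j _ => j.modNat) ?_ ?_ ?_
    · intro j hj
      simp only [Finset.mem_filter, Finset.mem_univ, true_and, Finset.mem_image] at hj ⊢
      rintro _ ⟨i, hi, rfl⟩
      have : a + h - 1 = (j.divNat : ℕ) := by linarith [hj.2]
      rw [this]
      exact hj.1.2 i hi
    · intro j hj j' hj' he
      simp only [Finset.mem_filter] at hj hj'
      have hd : j.divNat = j'.divNat := by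
        ext
        have := hj.2.trans hj'.2.symm
        omega
      apply finProdFinEquiv.symm.injective
      rw [finProdFinEquiv_symm_apply, finProdFinEquiv_symm_apply, hd, he]
    · intro c hc
      simp only [Finset.mem_filter, Finset.mem_univ, true_and, Finset.mem_image,
        forall_exists_index, and_imp, forall_apply_eq_imp_iff₂] at hc
      obtain ⟨R, hR⟩ : ∃ R : Fin L, ((R : ℕ) : ℤ) = a + h - 1 :=
        ⟨⟨(a + h - 1).toNat, by omega⟩, by simp; omega⟩
      have h3 := finProdFinEquiv.symm_apply_apply (R, c)
      rw [finProdFinEquiv_symm_apply, Prod.mk.injEq] at h3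
      refine ⟨finProdFinEquiv (R, c), ?_, h3.2⟩
      simp only [window, Finset.mem_filter, Finset.mem_univ, true_and]
      rw [h3.1, h3.2, hR]
      exact ⟨⟨⟨by linarith, by linarith⟩, hc⟩, by ring⟩
  · intro j hj
    have hj := (Finset.mem_filter.1 (Finset.mem_filter.1 hj).1).2
    exact Finset.mem_coe.2 (Finset.mem_Icc.2 hj)

theorem card_neighbors_inter {L : ℕ} (H : Fin (m + 1) → Matrix (Fin γ) (Fin κ) ℕ) {a p q : ℤ}
    (hp : 0 ≤ a + p - 1) (hq : a + q ≤ L) (i j : Fin ((L + m) * γ)) :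
    (neighbors (scMatrix L H) (window L κ a p q) i ∩
      neighbors (scMatrix L H) (window L κ a p q) j).card =
    ∑ h ∈ Finset.Icc p q, pairOverlap γ a (overlapParam H) i j h := by
  have := card_window_filter H hp hq {(i : ℤ), (j : ℤ)}
  simp only [Finset.image_insert, Finset.image_singleton] at this
  simp only [pairOverlap, ← this]
  congr 1
  ext c
  simp only [neighbors, Finset.mem_inter, Finset.mem_filter, scMatrix_eq_one_iff,
    Finset.mem_insert, Finset.mem_singleton, forall_eq_or_imp, forall_eq]
  tauto

theorem card_neighbors_inter_inter {L : ℕ} (H : Fin (m + 1) → Matrix (Fin γ) (Fin κ) ℕ)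
    {a p q : ℤ} (hp : 0 ≤ a + p - 1) (hq : a + q ≤ L) (i j l : Fin ((L + m) * γ)) :
    ((neighbors (scMatrix L H) (window L κ a p q) i ∩
      neighbors (scMatrix L H) (window L κ a p q) j) ∩
      (neighbors (scMatrix L H) (window L κ a p q) i ∩
      neighbors (scMatrix L H) (window L κ a p q) l)).card =
    ∑ h ∈ Finset.Icc p q, tripleOverlap γ a (overlapParam H) i j l h := by
  have := card_window_filter H hp hq {(i : ℤ), (j : ℤ), (l : ℤ)}
  simp only [Finset.image_insert, Finset.image_singleton] at this
  simp only [tripleOverlap, ← this]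
  congr 1
  ext c
  simp only [neighbors, Finset.mem_inter, Finset.mem_filter, scMatrix_eq_one_iff,
    Finset.mem_insert, Finset.mem_singleton, forall_eq_or_imp, forall_eq]
  tauto

theorem pairOverlap_eq_zero {H : Fin (m + 1) → Matrix (Fin γ) (Fin κ) ℕ}
    (hH : ∑ y, H y = Matrix.of fun _ _ => 1) {i j : ℤ} (hi : i % γ = j % γ) (hne : i ≠ j)
    (a h : ℤ) : pairOverlap γ a (overlapParam H) i j h = 0 := by
  refine overlapParam_eq_zero hH (i := i - (a + h - 1) * γ) (i' := j - (a + h - 1) * γ) ?_ ?_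
    (by simp) (by simp)
  · by_contra h'
    exact (emod_sub_ne_iff _ _ _ _).1 h' hi
  · simpa using hne

theorem sum_fin_eq_sum_Icc {M : Type*} [AddCommMonoid M] (n : ℕ) (f : ℤ → M) :
    ∑ i : Fin n, f i = ∑ i ∈ Finset.Icc (0 : ℤ) (n - 1), f i := by
  refine Finset.sum_bij (fun i _ => (i : ℤ)) ?_ ?_ ?_ ?_
  · intro i _
    have := i.2
    simp
  · intro i _ j _ h
    ext
    exact_mod_cast h
  · intro i hi
    rw [Finset.mem_Icc] at hi
    exact ⟨⟨i.toNat, by omega⟩, Finset.mem_univ _, by simp; omega⟩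
  · intros; rfl

/-- The number of instances of `P7` that have their variable nodes in a window of replicas. -/
theorem ncard_isPatternInstance_window {L : ℕ} {H : Fin (m + 1) → Matrix (Fin γ) (Fin κ) ℕ}
    (hH : ∑ y, H y = Matrix.of fun _ _ => 1) {a p q : ℤ}
    (hp : 0 ≤ a + p - 1) (hq : a + q ≤ L) :
    Set.ncard {S : Finset (Fin ((L + m) * γ) × Fin (L * κ)) |
      IsPatternInstance P7 (scMatrix L H) S ∧ ∀ e ∈ S, e.2 ∈ window L κ a p q} =
    sumPairs γ 0 (((L + m) * γ : ℕ) - 1) 0 (((L + m) * γ : ℕ) - 1) fun i₁ i₂ i₃ =>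
      caseA (∑ h ∈ Finset.Icc p q, pairOverlap γ a (overlapParam H) i₁ i₂ h)
        (∑ h ∈ Finset.Icc p q, pairOverlap γ a (overlapParam H) i₁ i₃ h)
        (∑ h ∈ Finset.Icc p q, tripleOverlap γ a (overlapParam H) i₁ i₂ i₃ h) := by
  rw [ncard_isPatternInstance_P7, sumPairs, ← sum_fin_eq_sum_Icc]
  refine Finset.sum_congr rfl fun c₁ _ => ?_
  rw [← sum_fin_eq_sum_Icc]
  refine Finset.sum_congr rfl fun c₂ _ => ?_
  rw [← sum_fin_eq_sum_Icc]
  refine Finset.sum_congr rfl fun c₃ _ => ?_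
  rw [card_neighbors_inter H hp hq, card_neighbors_inter H hp hq,
    card_neighbors_inter_inter H hp hq]
  have hcast : ∀ c c' : Fin ((L + m) * γ), ((c : ℕ) : ℤ) = (c' : ℕ) → c = c' := by
    intro c c' h
    ext
    exact_mod_cast h
  have hlt : ((c₂ : ℕ) : ℤ) < (c₃ : ℕ) ↔ c₂ < c₃ := by
    rw [Nat.cast_lt, Fin.lt_def]
  have hle : ∀ (x y : ℤ → ℕ), (∀ h, x h ≤ y h) →
      ∑ h ∈ Finset.Icc p q, x h ≤ ∑ h ∈ Finset.Icc p q, y h :=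
    fun x y h => Finset.sum_le_sum fun i _ => h i
  have hz2 := hle _ _ fun h => triple_le_left (overlapParam_antitone H)
    ((c₁ : ℤ) - (a + h - 1) * γ) ((c₂ : ℤ) - (a + h - 1) * γ) ((c₃ : ℤ) - (a + h - 1) * γ)
  have hz3 := hle _ _ fun h => triple_le_right (overlapParam_antitone H)
    ((c₁ : ℤ) - (a + h - 1) * γ) ((c₂ : ℤ) - (a + h - 1) * γ) ((c₃ : ℤ) - (a + h - 1) * γ)
  -- The graph count only excludes equal rows, the formula excludes congruent ones. The extra terms
  -- vanish because congruent distinct rows have zero overlap.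
  by_cases h12 : ((c₁ : ℕ) : ℤ) % γ = ((c₂ : ℕ) : ℤ) % γ
  · rw [if_neg (c := _ % _ ≠ _ ∧ _) (fun h => h.1 h12)]
    split_ifs with h
    · by_contra hne
      refine (caseA_ne_zero hz2 hz3 hne).1 (Finset.sum_eq_zero fun l _ => ?_)
      exact pairOverlap_eq_zero hH h12 (fun h' => h.1 (hcast _ _ h')) _ _
    · rfl
  by_cases h13 : ((c₁ : ℕ) : ℤ) % γ = ((c₃ : ℕ) : ℤ) % γ
  · rw [if_neg (c := _ % _ ≠ _ ∧ _) (fun h => h.2.1 h13)]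
    split_ifs with h
    · by_contra hne
      refine (caseA_ne_zero hz2 hz3 hne).2 (Finset.sum_eq_zero fun l _ => ?_)
      exact pairOverlap_eq_zero hH h13 (fun h' => h.2.1 (hcast _ _ h')) _ _
    · rfl
  have n12 : c₁ ≠ c₂ := by rintro rfl; exact h12 rfl
  have n13 : c₁ ≠ c₃ := by rintro rfl; exact h13 rfl
  simp only [ne_eq, h12, h13, n12, n13, hlt, not_false_eq_true, true_and]

end


/-! ### Spans of instances and the final count -/

section

variable {γ κ m L : ℕ}

/-- The variable nodes of `S` span exactly the `k` replicas that follow the first `a` ones. -/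
def SpansFrom {R : Type*} (S : Finset (R × Fin (L * κ))) (a k : ℕ) : Prop :=
  (∃ e ∈ S, (e.2.divNat : ℕ) = a) ∧ (∃ e ∈ S, (e.2.divNat : ℕ) + 1 = a + k) ∧
    ∀ e ∈ S, a ≤ (e.2.divNat : ℕ) ∧ (e.2.divNat : ℕ) + 1 ≤ a + k

theorem startsAtOneAndSpans_iff {R : Type*} (S : Finset (R × Fin (L * κ))) (k : ℕ) :
    StartsAtOneAndSpans S k ↔ SpansFrom S 0 k := by
  simp [StartsAtOneAndSpans, SpansFrom, replica]

theorem IsPatternInstance.nonempty_P7 {R C : Type*} {A : Matrix R C ℕ} {S : Finset (R × C)}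
    (h : IsPatternInstance P7 A S) : S.Nonempty := by
  obtain ⟨⟨f, g, hS⟩, -⟩ := h
  exact ⟨(f 0, g 0), (hS _).2 ⟨0, 0, by simp [P7], rfl⟩⟩

/-- The variable nodes of an instance lie in a span of at most `m + 1` replicas. -/
theorem divNat_le_of_isPatternInstance_P7 {H : Fin (m + 1) → Matrix (Fin γ) (Fin κ) ℕ}
    {S : Finset (Fin ((L + m) * γ) × Fin (L * κ))} (h : IsPatternInstance P7 (scMatrix L H) S)
    {e e' : Fin ((L + m) * γ) × Fin (L * κ)} (he : e ∈ S) (he' : e' ∈ S) :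
    (e.2.divNat : ℕ) ≤ e'.2.divNat + m := by
  obtain ⟨⟨f, g, hS⟩, hA⟩ := h
  -- The row `f 0` plays `c₁` and is joined to every variable node, so its block row confines all of
  -- them.
  have key : ∀ e ∈ S, (e.2.divNat : ℕ) ≤ ((f 0).divNat : ℕ) ∧
      ((f 0).divNat : ℕ) ≤ e.2.divNat + m := by
    intro e he
    obtain ⟨x, y, -, rfl⟩ := (hS e).1 he
    have h1 := hA (f 0, g y) ((hS _).2 ⟨0, y, by fin_cases y <;> simp [P7], rfl⟩)
    simp only [scMatrix, Matrix.of_apply] at h1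
    obtain ⟨z, -, hz⟩ := Finset.exists_ne_zero_of_sum_ne_zero (h1.trans_ne one_ne_zero)
    have hz' : ((f 0).divNat : ℕ) = ((g y).divNat : ℕ) + z := by
      by_contra hne
      exact hz (if_neg hne)
    have := z.2
    dsimp only
    omega
  have h1 := key e he
  have h2 := key e' he'
  omega

theorem formulaP7_eq_formula4 (γ m : ℕ) {k : ℕ} (hk : 2 ≤ k) (t : Finset ℤ → ℕ) :
    formulaP7 γ m k t = formula4 γ m k t := by
  unfold formulaP7
  rw [if_neg (by omega)]
  split_ifs with h2 h3
  · rw [h2, formula2_eq_formula4, Nat.cast_ofNat]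
  · rw [h3, formula3_eq_formula4, Nat.cast_ofNat]
  · rfl

/-- The number of instances that span given consecutive replicas. -/
theorem ncard_spansFrom (hγ : 1 ≤ γ) {H : Fin (m + 1) → Matrix (Fin γ) (Fin κ) ℕ}
    (hH : ∑ y, H y = Matrix.of fun _ _ => 1) {a k : ℕ} (hk : 1 ≤ k) (hak : a + k ≤ L) :
    Set.ncard {S : Finset (Fin ((L + m) * γ) × Fin (L * κ)) |
      IsPatternInstance P7 (scMatrix L H) S ∧ SpansFrom S a k} =
    formulaP7 γ m k (overlapParam H) := by
  have hγ' : (1 : ℤ) ≤ γ := by exact_mod_cast hγ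
  have hB : ((a : ℤ) + k + m) * γ - 1 ≤ (((L + m) * γ : ℕ) : ℤ) - 1 := by
    push_cast
    have : (a : ℤ) + k ≤ L := by exact_mod_cast hak
    gcongr
  -- `U p q` collects the instances within replicas `p, …, q`, counted from the first `a` ones.
  let U : ℤ → ℤ → Set (Finset (Fin ((L + m) * γ) × Fin (L * κ))) := fun p q =>
    {S | IsPatternInstance P7 (scMatrix L H) S ∧ ∀ e ∈ S, e.2 ∈ window L κ a p q}
  have hU : ∀ p q S, S ∈ U p q ↔ IsPatternInstance P7 (scMatrix L H) S ∧
      ∀ e ∈ S, p ≤ (e.2.divNat : ℕ) - (a : ℤ) + 1 ∧ (e.2.divNat : ℕ) - (a : ℤ) + 1 ≤ q := by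
    intro p q S
    simp only [U, window, Set.mem_ofPred_eq, Finset.mem_filter, Finset.mem_univ, true_and]
  have hcard : ∀ p q : ℤ, 1 ≤ p → q ≤ k → (U p q).ncard = _ := fun p q hp hq =>
    ncard_isPatternInstance_window hH (a := a) (p := p) (q := q) (by omega) (by omega)
  rcases hk.eq_or_lt with rfl | hk
  · have hB' : ((a : ℤ) + 1 + m) * γ - 1 ≤ (((L + m) * γ : ℕ) : ℤ) - 1 := by
      rwa [Nat.cast_one] at hB
    rw [formulaP7, if_pos rfl, formula1_eq (overlapParam_bounds H) (overlapParam_antitone H) hγ'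
      (Int.natCast_nonneg a) hB']
    have h1 := hcard 1 1 le_rfl (by simp)
    simp only [Finset.Icc_self, Finset.sum_singleton] at h1
    rw [← h1]
    congr 1
    ext S
    rw [hU]
    refine and_congr_right fun hS => ⟨fun h e he => ?_, fun h => ?_⟩
    · have := h.2.2 e he
      omega
    · obtain ⟨e, he⟩ := hS.nonempty_P7
      have := h e he
      refine ⟨⟨e, he, by omega⟩, ⟨e, he, by omega⟩, fun e' he' => ?_⟩
      have := h e' he'
      omega
  -- An instance spans the whole window exactly when it fits in it but in neither window with one
  -- end removed.
  · have hE : {S | IsPatternInstance P7 (scMatrix L H) S ∧ SpansFrom S a k} =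
        U 1 k \ (U 2 k ∪ U 1 (k - 1)) := by
      ext S
      simp only [Set.mem_ofPred_eq, Set.mem_sdiff, Set.mem_union, hU]
      constructor
      · rintro ⟨hS, ⟨e, he, h1⟩, ⟨e', he', h2⟩, h3⟩
        refine ⟨⟨hS, fun f hf => ?_⟩, ?_⟩
        · have := h3 f hf
          omega
        · rintro (⟨-, h⟩ | ⟨-, h⟩)
          · have := h e he
            omega
          · have := h e' he'
            omega
      · rintro ⟨⟨hS, h⟩, h'⟩
        push Not at h'
        obtain ⟨e, he, h1⟩ := h'.1 hS
        obtain ⟨e', he', h2⟩ := h'.2 hS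
        refine ⟨hS, ⟨e, he, ?_⟩, ⟨e', he', ?_⟩, fun f hf => ?_⟩
        · have := h e he
          omega
        · have := h e' he'
          omega
        · have := h f hf
          omega
    -- For `k = 2` the window on the right is empty.
    have hinter : U 2 k ∩ U 1 (k - 1) = U 2 (k - 1) := by
      ext S
      simp only [Set.mem_inter_iff, hU]
      constructor
      · rintro ⟨⟨hS, h⟩, -, h'⟩
        exact ⟨hS, fun e he => ⟨(h e he).1, (h' e he).2⟩⟩
      · rintro ⟨hS, h⟩
        refine ⟨⟨hS, fun e he => ?_⟩, hS, fun e he => ?_⟩ <;> have := h e he <;> omega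
    have hsub : U 2 k ∪ U 1 (k - 1) ⊆ U 1 k := by
      intro S
      simp only [Set.mem_union, hU]
      rintro (⟨hS, h⟩ | ⟨hS, h⟩) <;> refine ⟨hS, fun e he => ?_⟩ <;> have := h e he <;> omega
    have e1 := Set.ncard_sdiff_add_ncard_of_subset hsub (Set.toFinite _)
    have e2 := Set.ncard_union_add_ncard_inter (U 2 k) (U 1 (k - 1)) (Set.toFinite _)
      (Set.toFinite _)
    rw [hinter] at e2
    have e3 : (U 1 k).ncard + (U 2 (k - 1)).ncard = (U 2 k).ncard + (U 1 (k - 1)).ncard +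
        formulaP7 γ m k (overlapParam H) := by
      rw [formulaP7_eq_formula4 γ m hk, formula4_eq (overlapParam_bounds H)
        (overlapParam_antitone H) hγ' (Int.natCast_nonneg a) (by exact_mod_cast hk) hB,
        hcard 1 k le_rfl le_rfl, hcard 2 (k - 1) (by omega) (by omega),
        hcard 2 k (by omega) le_rfl, hcard 1 (k - 1) le_rfl (by omega)]
      simp only [← sumPairs_add]
      congr 1
      funext i₁ i₂ i₃
      exact caseA_window _ _ _
        (fun h => triple_le_left (overlapParam_antitone H) _ _ _)
        (fun h => triple_le_right (overlapParam_antitone H) _ _ _) k (by exact_mod_cast hk)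
    rw [hE]
    omega

theorem exists_spansFrom {R : Type*} {S : Finset (R × Fin (L * κ))} (hS : S.Nonempty) :
    ∃ k a, 1 ≤ k ∧ a + k ≤ L ∧ SpansFrom S a k := by
  obtain ⟨e, he, hmin⟩ := Finset.exists_min_image S (fun e => (e.2.divNat : ℕ)) hS
  obtain ⟨e', he', hmax⟩ := Finset.exists_max_image S (fun e => (e.2.divNat : ℕ)) hS
  have h := hmin e' he'
  have := e'.2.divNat.2
  refine ⟨(e'.2.divNat : ℕ) + 1 - e.2.divNat, e.2.divNat, by omega, by omega, ⟨e, he, rfl⟩,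
    ⟨e', he', by omega⟩, fun f hf => ?_⟩
  have := hmin f hf
  have := hmax f hf
  omega

theorem SpansFrom.unique {R : Type*} {S : Finset (R × Fin (L * κ))} {a k a' k' : ℕ}
    (h : SpansFrom S a k) (h' : SpansFrom S a' k') : a = a' ∧ k = k' := by
  obtain ⟨⟨e, he, h1⟩, ⟨f, hf, h2⟩, h3⟩ := h
  obtain ⟨⟨e', he', h1'⟩, ⟨f', hf', h2'⟩, h3'⟩ := h'
  have := h3 e' he'
  have := h3 f' hf'
  have := h3' e he
  have := h3' f hf
  omega

/-- The instances are partitioned by their span `(k, a)`. The admissible starts are `a < L + 1 - k`,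
and the number of instances does not depend on `a`. -/
theorem numP7_eq_sum (hγ : 1 ≤ γ) (hL : m + 1 ≤ L) {H : Fin (m + 1) → Matrix (Fin γ) (Fin κ) ℕ}
    (hH : ∑ y, H y = Matrix.of fun _ _ => 1) :
    numP7 L H = ∑ k ∈ Finset.Icc 1 (m + 1), (L + 1 - k) * formulaP7 γ m k (overlapParam H) := by
  classical
  let I : Finset (Finset (Fin ((L + m) * γ) × Fin (L * κ))) :=
    Finset.univ.filter fun S => IsPatternInstance P7 (scMatrix L H) S
  let D : Finset (Σ _ : ℕ, ℕ) := (Finset.Icc 1 (m + 1)).sigma fun k => Finset.range (L + 1 - k)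
  have hI : numP7 L H = I.card := by
    rw [numP7, ← Set.ncard_coe_finset]
    congr 1
    ext S
    simp [I]
  have hunion : I = D.biUnion fun d => I.filter fun S => SpansFrom S d.2 d.1 := by
    ext S
    simp only [Finset.mem_biUnion, Finset.mem_filter]
    constructor
    · intro hS
      have hS' := (Finset.mem_filter.1 hS).2
      obtain ⟨k, a, hk, hak, hspan⟩ := exists_spansFrom hS'.nonempty_P7
      refine ⟨⟨k, a⟩, ?_, hS, hspan⟩
      obtain ⟨e, he, h1⟩ := hspan.1
      obtain ⟨e', he', h2⟩ := hspan.2.1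
      have := divNat_le_of_isPatternInstance_P7 hS' he' he
      simp only [D, Finset.mem_sigma, Finset.mem_Icc, Finset.mem_range]
      omega
    · rintro ⟨_, _, hS, _⟩
      exact hS
  rw [hI, hunion, Finset.card_biUnion, Finset.sum_sigma]
  · refine Finset.sum_congr rfl fun k hk => ?_
    rw [Finset.mem_Icc] at hk
    rw [Finset.sum_congr rfl (g := fun _ => formulaP7 γ m k (overlapParam H)), Finset.sum_const,
      Finset.card_range, smul_eq_mul]
    intro a ha
    rw [Finset.mem_range] at ha
    rw [← ncard_spansFrom hγ hH (a := a) hk.1 (by omega : a + k ≤ L), ← Set.ncard_coe_finset]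
    congr 1
    ext S
    simp [I]
  · rintro ⟨k, a⟩ - ⟨k', a'⟩ - hne
    refine Finset.disjoint_left.2 ?_
    intro S hS hS'
    obtain ⟨rfl, rfl⟩ := (Finset.mem_filter.1 hS).2.unique (Finset.mem_filter.1 hS').2
    exact hne rfl

end

end SCCode

theorem mainTheorem2 (γ κ m L : ℕ) (hγ : 3 ≤ γ) (hL : m + 1 ≤ L)
    (H : Fin (m + 1) → Matrix (Fin γ) (Fin κ) ℕ)
    (hH : ∑ y, H y = Matrix.of fun _ _ => 1) :
    (∀ k ∈ Finset.Icc 1 (m + 1),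
      SCCode.numP7Span L H k = SCCode.formulaP7 γ m k (SCCode.overlapParam H)) ∧
    (SCCode.numP7 L H : ℤ) =
      ∑ k ∈ Finset.Icc 1 (m + 1),
        ((L : ℤ) - (k : ℤ) + 1) * (SCCode.formulaP7 γ m k (SCCode.overlapParam H) : ℤ) := by
  constructor
  · intro k hk
    rw [Finset.mem_Icc] at hk
    rw [← SCCode.ncard_spansFrom (by omega) hH (a := 0) hk.1 (by omega : 0 + k ≤ L)]
    simp only [SCCode.numP7Span, SCCode.startsAtOneAndSpans_iff]
  · rw [SCCode.numP7_eq_sum (by omega) hL hH]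
    push_cast
    refine Finset.sum_congr rfl fun k hk => ?_
    rw [Finset.mem_Icc] at hk
    -- The subtraction is not truncated, since `k ≤ m + 1 ≤ L`.
    rw [Nat.cast_sub (by omega)]
    push_cast
    ring
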